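/- For a Borel probability measure $\mu$ on $\mathbb{C}$ with compact support let $I(\mu)=\iint -\log|z-w|\,d\mu(z)\,d\mu(w)\in(-\infty,+\infty]$, and for $E\subseteq\mathbb{C}$ let $\mathrm{Cap}(E)=\exp(-\inf_\mu I(\mu))$ be its logarithmic capacity, where the infimum is over all Borel probability measures $\mu$ whose support is a compact subset of $E$, and $e^{-\infty}=0$. \begin{theorem} Let $J\subset\mathbb{R}$ be a bounded interval with more than one point (open, closed or half-open; for example $J=[0,1]$). Let $c_0,c_1,c_2,\dots$ be independent, identically distributed real random variables whose common law is absolutely continuous on $J$, that is, of the form $f(x)\,dx|_J$, with a density $f$ that satisfies $0<f(x)\le M$ for Lebesgue-almost every $x\in J$ and some constant $M$. Fix $\lambda>0$, put $l_k=e^{-\lambda k}$, let $I_k=(c_k-l_k/2,\;c_k+l_k/2)$ be the open interval with center $c_k$ and length $l_k$, and let $$S=\bigcap_{m}\bigcup_{k\ge m}I_k .$$ Then, almost surely, $S$ has full capacity on $J$: $$S\subseteq J\qquad\text{and}\qquad \mathrm{Cap}(S)=\mathrm{Cap}(J)>0 .$$ In particular, for $J=[0,1]$, almost surely $\mathrm{Cap}(S)=\mathrm{Cap}([0,1])>0$.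 \end{theorem} -/

import Mathlib

open MeasureTheory ProbabilityTheory

/-- The logarithmic kernel `-log |z - w|`, with the value `+∞` on the diagonal
(`ENNReal.log 0 = ⊥`). -/
noncomputable def logKernel (z w : ℂ) : EReal := -ENNReal.log (edist z w)

/-- The logarithmic energy `I(μ) = ∬ -log |z - w| dμ(z) dμ(w)`, as the integral of the positive part
of the kernel minus the integral of its negative part. For a finite measure with compact support
the second integral is finite, so that `I(μ)` is a well-defined element of `(-∞, +∞]`. -/
noncomputable def logEnergy (μ : Measure ℂ) : EReal :=
  ((∫⁻ z, ∫⁻ w, (logKernel z w).toENNReal ∂μ ∂μ : ENNReal) : EReal) -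
    ((∫⁻ z, ∫⁻ w, (-logKernel z w).toENNReal ∂μ ∂μ : ENNReal) : EReal)

/-- The logarithmic capacity `Cap(E) = exp (-inf I(μ))`, the infimum being over the Borel probability
measures on `ℂ` whose support is a compact subset of `E`, with `exp (-∞) = 0`. -/
noncomputable def logCapacity (E : Set ℂ) : ENNReal :=
  EReal.exp (-(⨅ μ ∈ {μ : Measure ℂ | IsProbabilityMeasure μ ∧
    IsCompact μ.support ∧ μ.support ⊆ E}, logEnergy μ))

/-- `E` has full capacity on `J`: it is a subset of `J` with the same capacity as `J`. -/
def HasFullCapacity (E J : Set ℂ) : Prop :=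
  E ⊆ J ∧ logCapacity E = logCapacity J

/-- The set `⋂ m, ⋃ k ≥ m, I k`, where `I k` is the open interval with center `c k` and
length `l k`. -/
def limsupIntervals (c l : ℕ → ℝ) : Set ℝ :=
  ⋂ m : ℕ, ⋃ k ≥ m, Set.Ioo (c k - l k / 2) (c k + l k / 2)

/-!
On a set of diameter at most `R` the kernel `-log |z - w|` differs by a constant from the
nonnegative kernel `log⁺ (R / |z - w|)`, so it suffices to show that `S` has the same minimal energy
`V` as `J` for the latter.

Averaging a measure over small translations barely changes its energy. Hence there is a probability
measure `ν` on `J` with bounded density and energy at most `V + ε`, and one can restrict it to a set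
on which the common law of the centers has a uniform positive lower density. Split the indices
into finite blocks and multiply `ν`, for each block, by a weighted average of the indicators of the
intervals `I k`, each normalised to have mean one. Two points in a common interval are correlated
with strength `1 / l k`, and as `ν ⊗ ν` gives mass of order `l k` and energy of order
`l k * log (1 / l k)` to the pairs at distance at most `l k`, the interval `I k` with weight `w k`
contributes of order `w k ^ 2 * L k` to the second moments, where `L k` is of order `log (1 / l k)`.
Since `∑ 1 / L k` diverges, weights proportional to `1 / L k` make the contribution of a long block
as small as desired.

The random measure thus has mean mass `1`, mean squared mass at most `1 + ε` and mean energy at most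
`V + 2ε`, while its energy is always at least `V` times its squared mass. So with high probability
its mass is close to `1` and its normalised energy close to `V`. It lives on the compact set of
points of the support of `ν` covered in each of the blocks, and lower semicontinuity of the energy
provides, with high probability, a measure of energy close to `V` on the points of `J` covered
infinitely often. Letting `ε → 0` shows that almost surely `S ∩ J` has minimal energy at most `V`.

Finally `S ⊆ J`: limit points of the centers lie in the closure of `J`, and by Borel–Cantelli the
endpoints are almost surely covered only finitely often.
-/

open scoped ENNReal NNReal Topology BoundedContinuousFunction
open Filter Set TopologicalSpace

section Energy

variable {X : Type*} [MeasurableSpace X] {κ : X × X → ℝ≥0∞} {μ ν : Measure X}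

/-- The energy `∬ κ(x, y) dμ(x) dμ(y)` of a measure with respect to a nonnegative kernel. -/
noncomputable def energy (κ : X × X → ℝ≥0∞) (μ : Measure X) : ℝ≥0∞ :=
  ∫⁻ p, κ p ∂(μ.prod μ)

lemma energy_mono [SFinite ν] (h : μ ≤ ν) : energy κ μ ≤ energy κ ν :=
  lintegral_mono' (Measure.prod_mono h h) le_rfl

lemma energy_one [SFinite μ] : energy (fun _ => 1) μ = μ univ ^ 2 := by
  rw [energy, lintegral_one, ← univ_prod_univ, Measure.prod_prod, sq]

lemma energy_smul [SFinite μ] (c : ℝ≥0∞) : energy κ (c • μ) = c ^ 2 * energy κ μ := by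
  rw [energy, Measure.prod_smul_left, Measure.prod_smul_right, smul_smul, lintegral_smul_measure,
    smul_eq_mul, sq, energy]

lemma energy_withDensity [SFinite μ] {w : X → ℝ≥0∞} (hκ : Measurable κ) (hw : Measurable w) :
    energy κ (μ.withDensity w) = energy (fun p => κ p * (w p.1 * w p.2)) μ := by
  rw [energy, prod_withDensity hw hw, lintegral_withDensity_eq_lintegral_mul _ (by fun_prop) hκ]
  simp only [Pi.mul_apply, mul_comm, energy]

lemma energy_map {Y : Type*} [MeasurableSpace Y] [SFinite μ] {φ : X → Y} {κ' : Y × Y → ℝ≥0∞}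
    (hφ : Measurable φ) (hκ' : Measurable κ') :
    energy κ' (μ.map φ) = energy (fun p => κ' (φ p.1, φ p.2)) μ := by
  rw [energy, Measure.map_prod_map _ _ hφ hφ, lintegral_map hκ' (hφ.prodMap hφ)]
  rfl

end Energy

section CompactlySupported

variable {X : Type*} [TopologicalSpace X] [MeasurableSpace X] {κ : X × X → ℝ≥0∞} {E F K : Set X}
  {μ : Measure X}

/-- The probability measures whose support is a compact subset of `E`, the competitors in the
definition of the capacity of `E`. -/
def compactProbMeasures (E : Set X) : Set (Measure X) :=
  {μ | IsProbabilityMeasure μ ∧ IsCompact μ.support ∧ μ.support ⊆ E}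

/-- The infimum of the energies of the probability measures with compact support in `E`. -/
noncomputable def minEnergy (κ : X × X → ℝ≥0∞) (E : Set X) : ℝ≥0∞ :=
  ⨅ μ ∈ compactProbMeasures E, energy κ μ

lemma compactProbMeasures_mono (h : E ⊆ F) : compactProbMeasures E ⊆ compactProbMeasures F :=
  fun _ hμ => ⟨hμ.1, hμ.2.1, hμ.2.2.trans h⟩

lemma minEnergy_le (hμ : μ ∈ compactProbMeasures E) : minEnergy κ E ≤ energy κ μ :=
  iInf₂_le μ hμ

lemma mem_compactProbMeasures_of_measure_compl_eq_zero [T2Space X] [IsProbabilityMeasure μ]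
    (hK : IsCompact K) (hKE : K ⊆ E) (h : μ Kᶜ = 0) : μ ∈ compactProbMeasures E := by
  have hsupp : μ.support ⊆ K := Measure.support_subset_of_isClosed hK.isClosed h
  exact ⟨inferInstance, hK.of_isClosed_subset Measure.isClosed_support hsupp, hsupp.trans hKE⟩

lemma minEnergy_anti (h : E ⊆ F) : minEnergy κ F ≤ minEnergy κ E :=
  biInf_mono (compactProbMeasures_mono h)

lemma minEnergy_mul_sq_le [T2Space X] [IsFiniteMeasure μ] (hK : IsCompact K) (hKE : K ⊆ E)
    (h : μ Kᶜ = 0) : minEnergy κ E * μ univ ^ 2 ≤ energy κ μ := by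
  rcases eq_or_ne μ 0 with rfl | hμ
  · simp
  have : NeZero μ := ⟨hμ⟩
  have hmem : (μ univ)⁻¹ • μ ∈ compactProbMeasures E :=
    have : IsProbabilityMeasure ((μ univ)⁻¹ • μ) := isProbabilityMeasureSMul
    mem_compactProbMeasures_of_measure_compl_eq_zero hK hKE (by simp [h])
  calc minEnergy κ E * μ univ ^ 2
      ≤ energy κ ((μ univ)⁻¹ • μ) * μ univ ^ 2 := by gcongr; exact minEnergy_le hmem
    _ = ((μ univ)⁻¹ * μ univ) ^ 2 * energy κ μ := by rw [energy_smul]; ring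
    _ = energy κ μ := by
      rw [ENNReal.inv_mul_cancel (NeZero.ne _) (measure_ne_top _ _), one_pow, one_mul]

end CompactlySupported

lemma exists_monotone_boundedContinuousFunction_iSup_eq {X : Type*} [TopologicalSpace X]
    {f : X → ℝ≥0∞} (hf : Continuous f) :
    ∃ g : ℕ → X →ᵇ ℝ≥0, (Monotone fun n x => (g n x : ℝ≥0∞)) ∧ ∀ x, ⨆ n, (g n x : ℝ≥0∞) = f x := by
  have hne (n : ℕ) (x : X) : min (f x) n ≠ ⊤ := ne_top_of_le_ne_top (by simp) (min_le_right _ _)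
  have hle (n : ℕ) (x : X) : (min (f x) n).toNNReal ≤ n :=
    ENNReal.toNNReal_mono (ENNReal.natCast_ne_top n) (min_le_right _ _)
  have hcont (n : ℕ) : Continuous fun x => (min (f x) n).toNNReal :=
    ENNReal.continuousOn_toNNReal.comp_continuous (by fun_prop) (hne n)
  let g (n : ℕ) : X →ᵇ ℝ≥0 := BoundedContinuousFunction.mkOfBound ⟨_, hcont n⟩ n fun x y =>
    (NNReal.dist_eq _ _).trans_le (abs_sub_le_of_nonneg_of_le
      (NNReal.coe_nonneg _) (hle n x) (NNReal.coe_nonneg _) (hle n y))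
  have hg (n : ℕ) (x : X) : (g n x : ℝ≥0∞) = min (f x) n := ENNReal.coe_toNNReal (hne n x)
  refine ⟨g, fun m n hmn x => ?_, fun x => ?_⟩
  · simp only [hg]
    gcongr
  · simp only [hg]
    rw [← inf_iSup_eq, ENNReal.iSup_natCast, inf_top_eq]

section LowerSemicontinuity

variable {X : Type*} [TopologicalSpace X] [MeasurableSpace X]

lemma lowerSemicontinuous_lintegral_of_continuous [OpensMeasurableSpace X] {f : X → ℝ≥0∞}
    (hf : Continuous f) : LowerSemicontinuous fun μ : ProbabilityMeasure X => ∫⁻ x, f x ∂μ := by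
  obtain ⟨g, hmono, hg⟩ := exists_monotone_boundedContinuousFunction_iSup_eq hf
  have h (μ : ProbabilityMeasure X) : ∫⁻ x, f x ∂μ = ⨆ n, ∫⁻ x, g n x ∂μ := by
    simp only [← hg]
    exact lintegral_iSup (fun n => (g n).continuous.measurable.coe_nnreal_ennreal) hmono
  simp only [h]
  exact lowerSemicontinuous_iSup fun n =>
    (ProbabilityMeasure.continuous_lintegral_boundedContinuousFunction (g n)).lowerSemicontinuous

lemma lowerSemicontinuous_energy [PseudoMetrizableSpace X] [SecondCountableTopology X]
    [OpensMeasurableSpace X] {κ : X × X → ℝ≥0∞} (hκ : Continuous κ) :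
    LowerSemicontinuous fun μ : ProbabilityMeasure X => energy κ μ :=
  (lowerSemicontinuous_lintegral_of_continuous hκ).comp
    (ProbabilityMeasure.continuous_prod.comp (continuous_id.prodMk continuous_id))

lemma exists_energy_le_iInter [MetrizableSpace X] [SecondCountableTopology X] [BorelSpace X]
    {κ : X × X → ℝ≥0∞} (hκ : Continuous κ) (c : ℝ≥0∞) {K : ℕ → Set X} (hK : ∀ i, IsCompact (K i))
    (hanti : Antitone K) (h : ∃ᶠ i in atTop, ∃ μ ∈ compactProbMeasures (K i), energy κ μ ≤ c) :
    ∃ μ ∈ compactProbMeasures (⋂ i, K i), energy κ μ ≤ c := by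
  -- Mathlib's tightness criterion takes a sequence of compact sets: here the constant one `K i`.
  let C (i : ℕ) : Set (ProbabilityMeasure X) := {μ | ∀ _ : ℕ, μ (K i)ᶜ ≤ 0} ∩ {μ | energy κ μ ≤ c}
  have hC (i : ℕ) : IsCompact (C i) :=
    (isCompact_setOfPred_probabilityMeasure_mass_eq_compl_isCompact_le (u := fun _ => 0)
      (K := fun _ => K i) tendsto_const_nhds (fun _ => hK i) (Or.inl inferInstance)).inter_right
      ((lowerSemicontinuous_energy hκ).isClosed_preimage c)
  have hsub (i : ℕ) : C (i + 1) ⊆ C i := fun μ hμ =>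
    ⟨fun n => (μ.apply_mono (compl_subset_compl.2 (hanti i.le_succ))).trans (hμ.1 n), hμ.2⟩
  have hne (i : ℕ) : (C i).Nonempty := by
    obtain ⟨j, hij, μ, ⟨hμ, -, hsupp⟩, hle⟩ := frequently_atTop.1 h i
    have hnull : μ (K i)ᶜ = 0 := measure_mono_null (compl_subset_compl.2 (hsupp.trans (hanti hij)))
      Measure.measure_compl_support
    exact ⟨⟨μ, hμ⟩, fun _ => ((ProbabilityMeasure.null_iff_toMeasure_null ⟨μ, hμ⟩ _).2 hnull).le,
      hle⟩
  obtain ⟨μ, hμ⟩ := IsCompact.nonempty_iInter_of_sequence_nonempty_isCompact_isClosed C hsub hne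
    (hC 0) fun i => (hC i).isClosed
  rw [mem_iInter] at hμ
  refine ⟨μ, mem_compactProbMeasures_of_measure_compl_eq_zero ((hK 0).of_isClosed_subset
    (isClosed_iInter fun i => (hK i).isClosed) (iInter_subset K 0)) subset_rfl ?_, (hμ 0).2⟩
  rw [compl_iInter, measure_iUnion_null_iff]
  intro i
  rw [← ProbabilityMeasure.null_iff_toMeasure_null]
  exact le_antisymm ((hμ i).1 0) bot_le

end LowerSemicontinuity

section PosLog

/-- The positive part `log⁺` of the logarithm on `[0, ∞]`. -/
noncomputable def eposLog (x : ℝ≥0∞) : ℝ≥0∞ := (ENNReal.log x).toENNReal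

lemma eposLog_top : eposLog ⊤ = ⊤ := by simp [eposLog]

lemma eposLog_eq_top_iff {x : ℝ≥0∞} : eposLog x = ⊤ ↔ x = ⊤ := by simp [eposLog]

lemma eposLog_eq_zero {x : ℝ≥0∞} (hx : x ≤ 1) : eposLog x = 0 := by
  simpa [eposLog, EReal.toENNReal_eq_zero_iff]

lemma eposLog_ofReal {t : ℝ} (ht : 0 < t) :
    eposLog (ENNReal.ofReal t) = ENNReal.ofReal (Real.log t) := by
  rw [eposLog, ENNReal.log_ofReal_of_pos ht, EReal.toENNReal_of_ne_top (EReal.coe_ne_top _),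
    EReal.toReal_coe]

lemma eposLog_mono : Monotone eposLog := fun _ _ h =>
  EReal.toENNReal_le_toENNReal (ENNReal.log_monotone h)

lemma continuous_eposLog : Continuous eposLog :=
  EReal.continuous_toENNReal.comp ENNReal.continuous_log

@[fun_prop] lemma measurable_eposLog : Measurable eposLog := continuous_eposLog.measurable

lemma eposLog_mul_le (x y : ℝ≥0∞) : eposLog (x * y) ≤ eposLog x + eposLog y := by
  rw [eposLog, ENNReal.log_mul_add]
  exact EReal.toENNReal_add_le

lemma eposLog_mul {x y : ℝ≥0∞} (hx : 1 ≤ x) (hy : 1 ≤ y) :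
    eposLog (x * y) = eposLog x + eposLog y := by
  rw [eposLog, ENNReal.log_mul_add, EReal.toENNReal_add (ENNReal.zero_le_log_iff.2 hx)
    (ENNReal.zero_le_log_iff.2 hy), eposLog, eposLog]

lemma eposLog_div_le {R r : ℝ≥0∞} (hr : r ≠ 0) (hr' : r ≠ ⊤) (d : ℝ≥0∞) :
    eposLog (R / d) ≤ eposLog (R / r) + eposLog (r / d) := by
  have h : R / d = R / r * (r / d) := by
    rw [← mul_div_assoc, ENNReal.div_mul_cancel hr hr']
  exact h ▸ eposLog_mul_le _ _

lemma continuous_eposLog_div {R : ℝ≥0∞} (hR : R ≠ ⊤) :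
    Continuous fun d => eposLog (R / d) :=
  continuous_eposLog.comp (continuous_iff_continuousAt.2 fun _ =>
    ENNReal.Tendsto.const_div tendsto_id (Or.inr hR))

lemma eposLog_inv_add_eposLog {R d : ℝ≥0∞} (hR : 1 ≤ R) (hR' : R ≠ ⊤) (hd : d ≤ R) :
    eposLog d⁻¹ + eposLog R = eposLog (R / d) + eposLog d := by
  rcases le_total d 1 with h | h
  · rw [eposLog_eq_zero h, add_zero, ← eposLog_mul (ENNReal.one_le_inv.2 h) hR, mul_comm,
      div_eq_mul_inv]
  · have hd0 : d ≠ 0 := (zero_lt_one.trans_le h).ne'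
    have hd' : d ≠ ⊤ := ne_top_of_le_ne_top hR' hd
    have hRd : 1 ≤ R / d :=
      (ENNReal.le_div_iff_mul_le (Or.inl hd0) (Or.inl hd')).2 (by rwa [one_mul])
    rw [eposLog_eq_zero (ENNReal.inv_le_one.2 h), zero_add, ← eposLog_mul hRd h,
      ENNReal.div_mul_cancel hd0 hd']

lemma lintegral_eposLog_div_enorm {r : ℝ} (hr : 0 < r) :
    ∫⁻ t : ℝ, eposLog (ENNReal.ofReal r / ‖t‖ₑ) = ENNReal.ofReal (2 * r) := by
  have hne : ∀ᵐ t : ℝ, t ≠ 0 := compl_mem_ae_iff.2 (measure_singleton 0)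
  have hlog (t : ℝ) (ht : t ≠ 0) : eposLog (ENNReal.ofReal r / ‖t‖ₑ) =
      ENNReal.ofReal (Real.log r - Real.log t) := by
    have ht' : 0 < |t| := abs_pos.2 ht
    rw [Real.enorm_eq_ofReal_abs, ← ENNReal.ofReal_div_of_pos ht', eposLog_ofReal (by positivity),
      Real.log_div hr.ne' ht'.ne', Real.log_abs]
  have hle : -r ≤ r := by linarith
  have hint : IntervalIntegrable (fun t => Real.log r - Real.log t) volume (-r) r :=
    intervalIntegrable_const.sub intervalIntegral.intervalIntegrable_log'
  have hnonneg : 0 ≤ᵐ[volume.restrict (Ioc (-r) r)] fun t => Real.log r - Real.log t := by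
    filter_upwards [ae_restrict_mem measurableSet_Ioc, ae_restrict_of_ae hne] with t ht ht0
    rw [Pi.zero_apply, sub_nonneg, ← Real.log_abs t]
    exact Real.log_le_log (abs_pos.2 ht0) (abs_le.2 ⟨ht.1.le, ht.2⟩)
  calc ∫⁻ t : ℝ, eposLog (ENNReal.ofReal r / ‖t‖ₑ)
      = ∫⁻ t in Ioc (-r) r, ENNReal.ofReal (Real.log r - Real.log t) := by
        rw [← lintegral_indicator measurableSet_Ioc]
        refine lintegral_congr_ae (hne.mono fun t ht => ?_)
        by_cases htr : t ∈ Ioc (-r) r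
        · rw [indicator_of_mem htr, ← hlog t ht]
        · have hrt : r ≤ |t| := by
            rw [mem_Ioc, not_and_or, not_lt, not_le] at htr
            exact le_abs.2 (htr.symm.imp le_of_lt fun h => by linarith)
          rw [indicator_of_notMem htr]
          refine eposLog_eq_zero (ENNReal.div_le_of_le_mul ?_)
          rw [one_mul, Real.enorm_eq_ofReal_abs]
          exact ENNReal.ofReal_le_ofReal hrt
    _ = ENNReal.ofReal (∫ t in -r..r, Real.log r - Real.log t) := by
        rw [intervalIntegral.integral_of_le hle, ofReal_integral_eq_lintegral_ofReal
          ((intervalIntegrable_iff_integrableOn_Ioc_of_le hle).1 hint) hnonneg]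
    _ = ENNReal.ofReal (2 * r) := by
        rw [intervalIntegral.integral_sub intervalIntegrable_const
          intervalIntegral.intervalIntegrable_log', integral_log, intervalIntegral.integral_const,
          Real.log_neg_eq_log, smul_eq_mul]
        ring_nf

end PosLog

section LogKernel

variable {X Y : Type*} [PseudoEMetricSpace X] [PseudoEMetricSpace Y]

/-- The truncated logarithmic kernel `log⁺ (R / d(x, y))`. It is nonnegative, and on a set of
diameter at most `R` it differs from `-log d(x, y)` by the constant `log R`. -/
noncomputable def posLogKernel (R : ℝ≥0∞) (p : X × X) : ℝ≥0∞ := eposLog (R / edist p.1 p.2)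

lemma continuous_posLogKernel {R : ℝ≥0∞} (hR : R ≠ ⊤) :
    Continuous (posLogKernel R : X × X → ℝ≥0∞) :=
  (continuous_eposLog_div hR).comp continuous_edist

@[fun_prop] lemma measurable_posLogKernel [MeasurableSpace X] [SecondCountableTopology X]
    [OpensMeasurableSpace X] (R : ℝ≥0∞) : Measurable (posLogKernel R : X × X → ℝ≥0∞) :=
  measurable_eposLog.comp (by fun_prop)

lemma energy_posLogKernel_map [MeasurableSpace X] [OpensMeasurableSpace X] [MeasurableSpace Y]
    [BorelSpace Y] [SecondCountableTopology Y] (R : ℝ≥0∞) {φ : X → Y} (hφ : Isometry φ)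
    (μ : Measure X) [SFinite μ] :
    energy (posLogKernel R) (μ.map φ) = energy (posLogKernel R) μ := by
  rw [energy_map hφ.continuous.measurable (measurable_posLogKernel R)]
  simp only [posLogKernel, hφ.edist_eq, energy]

end LogKernel

section ClosedEmbedding

variable {X Y : Type*} [TopologicalSpace X] [MeasurableSpace X] [BorelSpace X]
  [TopologicalSpace Y] [MeasurableSpace Y] [BorelSpace Y]
  {φ : X → Y} {E : Set X}

lemma map_mem_compactProbMeasures [T2Space Y] [HereditarilyLindelofSpace X]
    (hφ : Topology.IsClosedEmbedding φ) {μ : Measure X} (hμ : μ ∈ compactProbMeasures E) :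
    μ.map φ ∈ compactProbMeasures (φ '' E) := by
  obtain ⟨hprob, hcomp, hsub⟩ := hμ
  have := Measure.isProbabilityMeasure_map hφ.continuous.aemeasurable (μ := μ)
  refine mem_compactProbMeasures_of_measure_compl_eq_zero (hcomp.image hφ.continuous)
    (image_mono hsub) ?_
  rw [hφ.measurableEmbedding.map_apply, preimage_compl, preimage_image_eq _ hφ.injective]
  exact Measure.measure_compl_support

lemma exists_map_eq_of_mem_compactProbMeasures_image [T2Space X] [HereditarilyLindelofSpace Y]
    (hφ : Topology.IsClosedEmbedding φ)
    {ν : Measure Y} (hν : ν ∈ compactProbMeasures (φ '' E)) :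
    ∃ μ ∈ compactProbMeasures E, μ.map φ = ν := by
  obtain ⟨hprob, hcomp, hsub⟩ := hν
  have hmap : (ν.comap φ).map φ = ν := by
    rw [hφ.measurableEmbedding.map_comap, Measure.restrict_eq_self_of_ae_mem]
    filter_upwards [Measure.support_mem_ae (μ := ν)] with y hy
    exact image_subset_range φ E (hsub hy)
  have hprob' : IsProbabilityMeasure (ν.comap φ) := by
    rw [← hmap] at hprob
    exact Measure.isProbabilityMeasure_of_map φ
  refine ⟨ν.comap φ, mem_compactProbMeasures_of_measure_compl_eq_zero
    (hφ.isCompact_preimage hcomp) ?_ ?_, hmap⟩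
  · exact (preimage_mono hsub).trans (preimage_image_eq E hφ.injective).subset
  · rw [← preimage_compl, ← hφ.measurableEmbedding.map_apply, hmap]
    exact Measure.measure_compl_support

end ClosedEmbedding

lemma minEnergy_posLogKernel_image {X Y : Type*} [MetricSpace X] [MeasurableSpace X] [BorelSpace X]
    [SecondCountableTopology X] [MetricSpace Y] [MeasurableSpace Y] [BorelSpace Y]
    [SecondCountableTopology Y] (R : ℝ≥0∞) {φ : X → Y} (hφ : Isometry φ)
    (hφ' : Topology.IsClosedEmbedding φ) (E : Set X) :
    minEnergy (posLogKernel R) (φ '' E) = minEnergy (posLogKernel R) E := by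
  refine le_antisymm (le_iInf₂ fun μ hμ => ?_) (le_iInf₂ fun ν hν => ?_)
  · have := hμ.1
    rw [← energy_posLogKernel_map R hφ]
    exact minEnergy_le (map_mem_compactProbMeasures hφ' hμ)
  · obtain ⟨μ, hμ, rfl⟩ := exists_map_eq_of_mem_compactProbMeasures_image hφ' hν
    have := hμ.1
    rw [energy_posLogKernel_map R hφ]
    exact minEnergy_le hμ

section Capacity

lemma coe_sub_coe_eq_of_add_eq_add {a b c d : ℝ≥0∞} (hb : b ≠ ⊤) (hd : d ≠ ⊤)
    (h : a + d = c + b) : (a : EReal) - b = c - d := by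
  lift b to ℝ≥0 using hb
  lift d to ℝ≥0 using hd
  have h' : (a : EReal) + (d : ℝ) = c + (b : ℝ) := by
    simpa only [EReal.coe_ennreal_add] using! congrArg ((↑) : ℝ≥0∞ → EReal) h
  calc (a : EReal) - (b : ℝ) = a + (d : ℝ) - (d : ℝ) - (b : ℝ) := by rw [EReal.add_sub_cancel_right]
    _ = c + (b : ℝ) - (b : ℝ) - (d : ℝ) := by rw [h']; simp only [sub_eq_add_neg, add_right_comm]
    _ = c - (d : ℝ) := by rw [EReal.add_sub_cancel_right]

variable {R : ℝ≥0∞} {E F : Set ℂ}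

lemma logEnergy_eq_energy_sub {ν : Measure ℂ} [IsProbabilityMeasure ν] (hR : 1 ≤ R) (hR' : R ≠ ⊤)
    (h : ∀ᵐ p ∂(ν.prod ν), edist p.1 p.2 ≤ R) :
    logEnergy ν = (energy (posLogKernel R) ν : EReal) - eposLog R := by
  have hm : Measurable fun p : ℂ × ℂ => eposLog (edist p.1 p.2) := by fun_prop
  have hpos : ∫⁻ z, ∫⁻ w, (logKernel z w).toENNReal ∂ν ∂ν =
      ∫⁻ p, eposLog (edist p.1 p.2)⁻¹ ∂(ν.prod ν) := by
    rw [lintegral_prod _ (by fun_prop)]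
    simp only [logKernel, eposLog, ENNReal.log_inv]
  have hneg : ∫⁻ z, ∫⁻ w, (-logKernel z w).toENNReal ∂ν ∂ν =
      ∫⁻ p, eposLog (edist p.1 p.2) ∂(ν.prod ν) := by
    rw [lintegral_prod _ (by fun_prop)]
    simp only [logKernel, eposLog, neg_neg]
  have hlogR : eposLog R ≠ ⊤ := mt eposLog_eq_top_iff.1 hR'
  rw [logEnergy, hpos, hneg]
  refine coe_sub_coe_eq_of_add_eq_add (ne_top_of_le_ne_top hlogR ?_) hlogR ?_
  · calc ∫⁻ p, eposLog (edist p.1 p.2) ∂(ν.prod ν) ≤ ∫⁻ _, eposLog R ∂(ν.prod ν) :=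
          lintegral_mono_ae (h.mono fun _ hp => eposLog_mono hp)
      _ = eposLog R := by simp
  · calc ∫⁻ p, eposLog (edist p.1 p.2)⁻¹ ∂(ν.prod ν) + eposLog R
        = ∫⁻ p, (eposLog (edist p.1 p.2)⁻¹ + eposLog R) ∂(ν.prod ν) := by
          rw [lintegral_add_right _ measurable_const, lintegral_const, measure_univ, mul_one]
      _ = ∫⁻ p, (posLogKernel R p + eposLog (edist p.1 p.2)) ∂(ν.prod ν) :=
          lintegral_congr_ae (h.mono fun _ hp => eposLog_inv_add_eposLog hR hR' hp)
      _ = energy (posLogKernel R) ν + ∫⁻ p, eposLog (edist p.1 p.2) ∂(ν.prod ν) :=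
          lintegral_add_right _ hm

lemma coe_iInf_sub_eq {ι : Sort*} (u : ι → ℝ≥0∞) {c : ℝ≥0∞} (hc : c ≠ ⊤) :
    ((⨅ i, u i : ℝ≥0∞) : EReal) - c = ⨅ i, ((u i : EReal) - c) := by
  have hmono : Monotone fun x : ℝ≥0∞ => (x : EReal) - c := fun x y hxy =>
    EReal.sub_le_sub (EReal.coe_ennreal_le_coe_ennreal_iff.2 hxy) le_rfl
  have hcont : Continuous fun x : ℝ≥0∞ => (x : EReal) - c := by
    refine continuous_iff_continuousAt.2 fun x => ?_
    exact (EReal.continuousAt_add (p := ((x : EReal), -(c : EReal))) (Or.inr (by simpa))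
      (Or.inr (by simp))).comp (f := fun x : ℝ≥0∞ => ((x : EReal), -(c : EReal)))
      (continuous_coe_ennreal_ereal.prodMk continuous_const).continuousAt
  exact hmono.map_iInf_of_continuousAt hcont.continuousAt (EReal.top_sub (by simpa))

lemma logCapacity_eq_exp_neg_minEnergy (hR : 1 ≤ R) (hR' : R ≠ ⊤)
    (hE : ∀ z ∈ E, ∀ w ∈ E, edist z w ≤ R) :
    logCapacity E = EReal.exp (-((minEnergy (posLogKernel R) E : EReal) - eposLog R)) := by
  have henergy (ν : compactProbMeasures E) :
      logEnergy ν = (energy (posLogKernel R) ν.1 : EReal) - eposLog R := by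
    have := ν.2.1
    have hsupp : ∀ᵐ z ∂ν.1, z ∈ E := mem_of_superset Measure.support_mem_ae ν.2.2.2
    refine logEnergy_eq_energy_sub hR hR' ?_
    filter_upwards [Measure.quasiMeasurePreserving_fst.ae hsupp,
      Measure.quasiMeasurePreserving_snd.ae hsupp] with p hp₁ hp₂
    exact hE _ hp₁ _ hp₂
  rw [minEnergy, iInf_subtype', coe_iInf_sub_eq _ (mt eposLog_eq_top_iff.1 hR')]
  simp only [← henergy]
  rw [logCapacity, iInf_subtype']
  rfl

lemma logCapacity_pos (hR : 1 ≤ R) (hR' : R ≠ ⊤) (hE : ∀ z ∈ E, ∀ w ∈ E, edist z w ≤ R)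
    (h : minEnergy (posLogKernel R) E ≠ ⊤) : 0 < logCapacity E := by
  rw [logCapacity_eq_exp_neg_minEnergy hR hR' hE, pos_iff_ne_zero, Ne, EReal.exp_eq_zero_iff,
    EReal.neg_eq_bot_iff]
  lift minEnergy (posLogKernel R) E to ℝ≥0 using h with v
  lift eposLog R to ℝ≥0 using mt eposLog_eq_top_iff.1 hR' with u
  exact EReal.coe_ne_top ((v : ℝ) - u)

lemma hasFullCapacity_of_minEnergy_le (hR : 1 ≤ R) (hR' : R ≠ ⊤)
    (hF : ∀ z ∈ F, ∀ w ∈ F, edist z w ≤ R) (hEF : E ⊆ F)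
    (h : minEnergy (posLogKernel R) E ≤ minEnergy (posLogKernel R) F) : HasFullCapacity E F := by
  refine ⟨hEF, ?_⟩
  rw [logCapacity_eq_exp_neg_minEnergy hR hR' hF,
    logCapacity_eq_exp_neg_minEnergy hR hR' fun z hz w hw => hF z (hEF hz) w (hEF hw),
    le_antisymm h (minEnergy_anti hEF)]

end Capacity

lemma measurePreserving_prodProdProdComm {X Y Z W : Type*} [MeasurableSpace X] [MeasurableSpace Y]
    [MeasurableSpace Z] [MeasurableSpace W] (μ : Measure X) (σ : Measure Y) (ν : Measure Z)
    (τ : Measure W) [SFinite μ] [SFinite σ] [SFinite ν] [SFinite τ] :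
    MeasurePreserving (Equiv.prodProdProdComm X Y Z W)
      ((μ.prod σ).prod (ν.prod τ)) ((μ.prod ν).prod (σ.prod τ)) := by
  have hswap : MeasurePreserving (Prod.map Prod.swap id) ((σ.prod ν).prod τ) ((ν.prod σ).prod τ) :=
    Measure.measurePreserving_swap.prod (MeasurePreserving.id τ)
  have hmid : MeasurePreserving _ (σ.prod (ν.prod τ)) (ν.prod (σ.prod τ)) :=
    (measurePreserving_prodAssoc ν σ τ).comp (hswap.comp (measurePreserving_prodAssoc σ ν τ).symm)
  exact (measurePreserving_prodAssoc μ ν (σ.prod τ)).symm.comp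
    (((MeasurePreserving.id μ).prod hmid).comp (measurePreserving_prodAssoc μ σ (ν.prod τ)))

lemma map_add_mul_prod_le {X : Type*} [MeasurableSpace X] (μ : Measure X) [IsProbabilityMeasure μ]
    {σ : Measure ℝ} [SFinite σ] {C : ℝ≥0∞} (hσ : σ ≤ C • volume) {g : X → ℝ} (hg : Measurable g)
    {s : ℝ} (hs : s ≠ 0) :
    (μ.prod σ).map (fun p => g p.1 + s * p.2) ≤ (C * ENNReal.ofReal |s⁻¹|) • volume := by
  refine Measure.le_intro fun A hA _ => ?_
  have hmeas : Measurable fun p : X × ℝ => g p.1 + s * p.2 := by fun_prop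
  rw [Measure.map_apply hmeas hA, Measure.prod_apply (hmeas hA)]
  calc ∫⁻ x, σ ((s * ·) ⁻¹' ((g x + ·) ⁻¹' A)) ∂μ
      ≤ ∫⁻ _, (C * ENNReal.ofReal |s⁻¹|) * volume A ∂μ := by
        refine lintegral_mono fun x => (hσ _).trans_eq ?_
        rw [Measure.smul_apply, Real.volume_preimage_mul_left hs, measure_preimage_add, smul_eq_mul,
          mul_assoc]
    _ = ((C * ENNReal.ofReal |s⁻¹|) • volume) A := by simp

section Smoothing

variable {R C : ℝ≥0∞} {L s d v : ℝ} {μ σ τ : Measure ℝ}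

lemma lintegral_posLogKernel_le {r : ℝ} (hr : 0 < r) (hσ : σ ≤ C • volume) (x : ℝ) :
    ∫⁻ y, posLogKernel (ENNReal.ofReal r) (x, y) ∂σ ≤ C * ENNReal.ofReal (2 * r) := by
  calc ∫⁻ y, posLogKernel (ENNReal.ofReal r) (x, y) ∂σ
      ≤ ∫⁻ y, posLogKernel (ENNReal.ofReal r) (x, y) ∂(C • volume) := lintegral_mono' hσ le_rfl
    _ = C * ∫⁻ y, eposLog (ENNReal.ofReal r / ‖x - y‖ₑ) := by
        simp only [lintegral_smul_measure, smul_eq_mul, posLogKernel, edist_eq_enorm_sub]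
    _ = C * ENNReal.ofReal (2 * r) := by
        rw [lintegral_sub_left_eq_self (fun t => eposLog (ENNReal.ofReal r / ‖t‖ₑ)),
          lintegral_eposLog_div_enorm hr]

lemma energy_posLogKernel_le {r : ℝ} (hr : 0 < r) [IsProbabilityMeasure σ] (hσ : σ ≤ C • volume) :
    energy (posLogKernel (ENNReal.ofReal r)) σ ≤ C * ENNReal.ofReal (2 * r) := by
  rw [energy, lintegral_prod _ (by fun_prop)]
  refine (lintegral_mono fun x => lintegral_posLogKernel_le hr hσ x).trans ?_
  simp

/-- The law of `(1 - s) X + s U`, where `X` and `U` are independent with laws `μ` and `σ`. -/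
noncomputable def smoothedMeasure (μ σ : Measure ℝ) (s : ℝ) : Measure ℝ :=
  (μ.prod σ).map fun p => (1 - s) * p.1 + s * p.2

/-- The kernel `log⁺ (R / |x|)` at `x = (1 - s) d + s V`, averaged over `V` with law `τ`. If `τ` is
the law of the difference of two independent variables with law `σ`, this is the interaction of two
points at signed distance `d` after smoothing by `σ`. -/
noncomputable def smoothedKernel (R : ℝ≥0∞) (τ : Measure ℝ) (s d : ℝ) : ℝ≥0∞ :=
  ∫⁻ v, eposLog (R / ‖(1 - s) * d + s * v‖ₑ) ∂τ

@[fun_prop] lemma measurable_smoothedKernel [SFinite τ] : Measurable (smoothedKernel R τ s) :=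
  Measurable.lintegral_prod_right'
    (f := fun p : ℝ × ℝ => eposLog (R / ‖(1 - s) * p.1 + s * p.2‖ₑ)) (by fun_prop)

lemma energy_smoothedMeasure [SFinite μ] [SFinite σ] :
    energy (posLogKernel R) (smoothedMeasure μ σ s) =
      ∫⁻ p, smoothedKernel R ((σ.prod σ).map fun u => u.1 - u.2) s (p.1 - p.2) ∂(μ.prod μ) := by
  let F (q : (ℝ × ℝ) × ℝ × ℝ) : ℝ≥0∞ :=
    eposLog (R / ‖(1 - s) * (q.1.1 - q.1.2) + s * (q.2.1 - q.2.2)‖ₑ)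
  have hF : Measurable F := by fun_prop
  calc energy (posLogKernel R) (smoothedMeasure μ σ s)
      = ∫⁻ q, F (Equiv.prodProdProdComm _ _ _ _ q) ∂((μ.prod σ).prod (μ.prod σ)) := by
        rw [smoothedMeasure, energy_map (by fun_prop) (by fun_prop), energy]
        refine lintegral_congr fun q => ?_
        simp only [F, posLogKernel, edist_eq_enorm_sub, Equiv.prodProdProdComm_apply]
        ring_nf
    _ = ∫⁻ p, ∫⁻ u, F (p, u) ∂(σ.prod σ) ∂(μ.prod μ) := by
        rw [(measurePreserving_prodProdProdComm μ σ μ σ).lintegral_comp hF,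
          lintegral_prod _ hF.aemeasurable]
    _ = _ := by
        refine lintegral_congr fun p => ?_
        rw [smoothedKernel, lintegral_map (by fun_prop) (by fun_prop)]

lemma abs_le_four_mul_abs (hs : 0 ≤ s) (hs' : s ≤ 1 / 2) (hv : |v| ≤ L) (hd : 4 * (s * L) ≤ |d|) :
    |d| ≤ 4 * |(1 - s) * d + s * v| := by
  have htri : |(1 - s) * d| ≤ |(1 - s) * d + s * v| + |s * v| := by
    simpa using! abs_sub ((1 - s) * d + s * v) (s * v)
  rw [abs_mul, abs_mul, abs_of_nonneg hs, abs_of_nonneg (by linarith : 0 ≤ 1 - s)] at htri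
  nlinarith [mul_le_mul_of_nonneg_left hv hs, abs_nonneg d]

lemma eposLog_div_le_of_le_mul {x y a : ℝ≥0∞} (ha : a ≠ 0) (ha' : a ≠ ⊤) (h : x ≤ a * y) :
    eposLog (R / y) ≤ eposLog (R / x) + eposLog a := by
  refine (eposLog_mono ?_).trans (eposLog_mul_le _ _)
  rw [mul_comm, ← mul_div_assoc, ← ENNReal.mul_div_mul_left R y ha ha']
  gcongr

lemma enorm_le_four_mul_enorm (hs : 0 ≤ s) (hs' : s ≤ 1 / 2) (hv : |v| ≤ L)
    (hd : 4 * (s * L) ≤ |d|) : ‖d‖ₑ ≤ 4 * ‖(1 - s) * d + s * v‖ₑ := by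
  rw [Real.enorm_eq_ofReal_abs, Real.enorm_eq_ofReal_abs, ← ENNReal.ofReal_ofNat,
    ← ENNReal.ofReal_mul (by norm_num)]
  exact ENNReal.ofReal_le_ofReal (abs_le_four_mul_abs hs hs' hv hd)

lemma eposLog_div_smoothed_le (hL : 0 < L) (hs : 0 < s) (hs' : s ≤ 1 / 2) (hv : |v| ≤ L) :
    eposLog (R / ‖(1 - s) * d + s * v‖ₑ) ≤ eposLog (R / ‖d‖ₑ) + eposLog 4 +
      eposLog (ENNReal.ofReal (s * L) / ‖(1 - s) * d + s * v‖ₑ) := by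
  rcases le_total (4 * (s * L)) |d| with hd | hd
  · exact (eposLog_div_le_of_le_mul (by norm_num) (by norm_num)
      (enorm_le_four_mul_enorm hs.le hs' hv hd)).trans le_self_add
  · have hd' : ‖d‖ₑ ≤ 4 * ENNReal.ofReal (s * L) := by
      rw [Real.enorm_eq_ofReal_abs, ← ENNReal.ofReal_ofNat, ← ENNReal.ofReal_mul (by norm_num)]
      exact ENNReal.ofReal_le_ofReal hd
    refine (eposLog_div_le (ENNReal.ofReal_pos.2 (mul_pos hs hL)).ne' ENNReal.ofReal_ne_top _).trans
      ?_
    exact add_le_add_left (eposLog_div_le_of_le_mul (by norm_num) (by norm_num) hd') _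

lemma lintegral_eposLog_div_smoothed_le (hτ : τ ≤ C • volume) (hL : 0 < L) (hs : 0 < s) :
    ∫⁻ v, eposLog (ENNReal.ofReal (s * L) / ‖(1 - s) * d + s * v‖ₑ) ∂τ ≤
      C * ENNReal.ofReal (2 * L) := by
  have hscale (v : ℝ) : ENNReal.ofReal (s * L) / ‖(1 - s) * d + s * v‖ₑ =
      ENNReal.ofReal L / edist (-((1 - s) * d / s)) v := by
    have : (1 - s) * d + s * v = -s * (-((1 - s) * d / s) - v) := by field_simp; ring
    rw [this, enorm_mul, enorm_neg, Real.enorm_of_nonneg hs.le, ENNReal.ofReal_mul hs.le,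
      ENNReal.mul_div_mul_left _ _ (by simpa) ENNReal.ofReal_ne_top, edist_eq_enorm_sub]
  simp only [hscale]
  exact lintegral_posLogKernel_le hL hτ _

lemma smoothedKernel_le [IsProbabilityMeasure τ] (hτ : τ ≤ C • volume) (hL : 0 < L)
    (hτL : ∀ᵐ v ∂τ, |v| ≤ L) (hs : 0 < s) (hs' : s ≤ 1 / 2) :
    smoothedKernel R τ s d ≤ eposLog (R / ‖d‖ₑ) + (eposLog 4 + C * ENNReal.ofReal (2 * L)) := by
  calc smoothedKernel R τ s d
      ≤ ∫⁻ v, eposLog (R / ‖d‖ₑ) + eposLog 4 +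
          eposLog (ENNReal.ofReal (s * L) / ‖(1 - s) * d + s * v‖ₑ) ∂τ :=
        lintegral_mono_ae (hτL.mono fun v hv => eposLog_div_smoothed_le hL hs hs' hv)
    _ ≤ eposLog (R / ‖d‖ₑ) + (eposLog 4 + C * ENNReal.ofReal (2 * L)) := by
        rw [lintegral_add_left measurable_const, lintegral_const, measure_univ, mul_one, add_assoc]
        gcongr
        exact lintegral_eposLog_div_smoothed_le hτ hL hs

lemma tendsto_smoothedKernel [IsProbabilityMeasure τ] (hR : R ≠ ⊤) (hτL : ∀ᵐ v ∂τ, |v| ≤ L)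
    (hd : d ≠ 0) :
    Tendsto (fun s => smoothedKernel R τ s d) (𝓝[>] 0) (𝓝 (eposLog (R / ‖d‖ₑ))) := by
  have hd' : 0 < |d| := abs_pos.2 hd
  have hsmall : ∀ᶠ s : ℝ in 𝓝[>] 0, 0 < s ∧ s ≤ 1 / 2 ∧ 4 * (s * L) ≤ |d| := by
    have hlim : Tendsto (fun s : ℝ => 4 * (s * L)) (𝓝[>] 0) (𝓝 0) :=
      (Continuous.tendsto' (by fun_prop) 0 0 (by simp)).mono_left nhdsWithin_le_nhds
    filter_upwards [self_mem_nhdsWithin, Ioc_mem_nhdsGT (by norm_num : (0 : ℝ) < 1 / 2),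
      hlim.eventually_le_const hd'] with s h₁ h₂ h₃ using ⟨h₁, h₂.2, h₃⟩
  have hlim : Tendsto (fun s => smoothedKernel R τ s d) (𝓝[>] 0)
      (𝓝 (∫⁻ _, eposLog (R / ‖d‖ₑ) ∂τ)) := by
    refine tendsto_lintegral_filter_of_dominated_convergence
      (fun _ => eposLog (R / ‖d‖ₑ) + eposLog 4) (Eventually.of_forall fun s => by fun_prop) ?_ ?_ ?_
    · filter_upwards [hsmall] with s ⟨hs, hs', hsd⟩
      filter_upwards [hτL] with v hv
      exact eposLog_div_le_of_le_mul (by norm_num) (by norm_num)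
        (enorm_le_four_mul_enorm hs.le hs' hv hsd)
    · simp [ENNReal.add_eq_top, eposLog_eq_top_iff, ENNReal.div_eq_top, hd, hR]
    · refine Eventually.of_forall fun v => Tendsto.mono_left ?_ nhdsWithin_le_nhds
      exact ((continuous_eposLog_div hR).comp (by fun_prop :
        Continuous fun s : ℝ => ‖(1 - s) * d + s * v‖ₑ)).tendsto' 0 _ (by simp)
  simpa using hlim

lemma tendsto_energy_smoothedMeasure [IsProbabilityMeasure μ] [IsProbabilityMeasure σ] {a b : ℝ}
    (hR : R ≠ 0) (hR' : R ≠ ⊤) (hμ : energy (posLogKernel R) μ ≠ ⊤) (hab : a < b) (hC : C ≠ ⊤)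
    (hσ : σ ≤ C • volume) (hσab : ∀ᵐ u ∂σ, u ∈ Icc a b) :
    Tendsto (fun s => energy (posLogKernel R) (smoothedMeasure μ σ s)) (𝓝[>] 0)
      (𝓝 (energy (posLogKernel R) μ)) := by
  let τ : Measure ℝ := (σ.prod σ).map fun u => u.1 - u.2
  have : IsProbabilityMeasure τ := Measure.isProbabilityMeasure_map (by fun_prop)
  have hτ : τ ≤ C • volume := by
    simpa [τ, sub_eq_add_neg] using map_add_mul_prod_le σ hσ measurable_id (s := -1) (by norm_num)
  have hτL : ∀ᵐ v ∂τ, |v| ≤ b - a := by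
    rw [ae_map_iff (by fun_prop) (measurableSet_le (by fun_prop) (by fun_prop))]
    filter_upwards [Measure.quasiMeasurePreserving_fst.ae hσab,
      Measure.quasiMeasurePreserving_snd.ae hσab] with u hu₁ hu₂
    exact abs_sub_le_of_le_of_le hu₁.1 hu₁.2 hu₂.1 hu₂.2
  have hL : 0 < b - a := sub_pos.2 hab
  simp only [energy_smoothedMeasure]
  refine tendsto_lintegral_filter_of_dominated_convergence
    (fun p => posLogKernel R p + (eposLog 4 + C * ENNReal.ofReal (2 * (b - a))))
    (Eventually.of_forall fun s => by fun_prop) ?_ ?_ ?_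
  · filter_upwards [self_mem_nhdsWithin, Ioc_mem_nhdsGT (by norm_num : (0 : ℝ) < 1 / 2)]
      with s hs hs'
    refine Eventually.of_forall fun p => ?_
    rw [posLogKernel, edist_eq_enorm_sub]
    exact smoothedKernel_le hτ hL hτL hs hs'.2
  · rw [lintegral_add_right _ measurable_const, lintegral_const, measure_univ, mul_one]
    exact ENNReal.add_ne_top.2 ⟨hμ, ENNReal.add_ne_top.2
      ⟨mt eposLog_eq_top_iff.1 (by norm_num), ENNReal.mul_ne_top hC ENNReal.ofReal_ne_top⟩⟩
  · filter_upwards [ae_lt_top (measurable_posLogKernel R) hμ] with p hp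
    rw [posLogKernel, edist_eq_enorm_sub] at hp ⊢
    refine tendsto_smoothedKernel hR' hτL fun h => hp.ne ?_
    rw [h, enorm_zero, ENNReal.div_zero hR, eposLog_top]

lemma smoothedMeasure_mem_compactProbMeasures {J : Set ℝ} (hJ : J.OrdConnected)
    (hμ : μ ∈ compactProbMeasures J) (hσ : σ ∈ compactProbMeasures J) (hs : s ∈ Icc (0 : ℝ) 1) :
    smoothedMeasure μ σ s ∈ compactProbMeasures J := by
  have := hμ.1
  have := hσ.1
  have : IsProbabilityMeasure (smoothedMeasure μ σ s) :=
    Measure.isProbabilityMeasure_map (by fun_prop)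
  let φ (p : ℝ × ℝ) : ℝ := (1 - s) * p.1 + s * p.2
  have hφ : Continuous φ := by fun_prop
  have hK : IsCompact (φ '' (μ.support ×ˢ σ.support)) := (hμ.2.1.prod hσ.2.1).image hφ
  refine mem_compactProbMeasures_of_measure_compl_eq_zero hK ?_ ?_
  · rintro _ ⟨p, ⟨hp₁, hp₂⟩, rfl⟩
    exact hJ.convex (hμ.2.2 hp₁) (hσ.2.2 hp₂) (sub_nonneg.2 hs.2) hs.1 (sub_add_cancel 1 s)
  · rw [← mem_ae_iff, smoothedMeasure, mem_ae_map_iff hφ.aemeasurable hK.measurableSet]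
    filter_upwards [Measure.quasiMeasurePreserving_fst.ae Measure.support_mem_ae,
      Measure.quasiMeasurePreserving_snd.ae Measure.support_mem_ae] with p hp₁ hp₂
    exact mem_image_of_mem φ ⟨hp₁, hp₂⟩

lemma exists_mem_compactProbMeasures_Icc_le_smul_volume {a b : ℝ} (hab : a < b) :
    ∃ σ ∈ compactProbMeasures (Icc a b), ∃ C : ℝ≥0∞, C ≠ ⊤ ∧ σ ≤ C • (volume : Measure ℝ) := by
  have hvol : volume (Icc a b) ≠ 0 := by simpa
  have := cond_isProbabilityMeasure_of_finite hvol (by simp)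
  refine ⟨volume[|Icc a b], mem_compactProbMeasures_of_measure_compl_eq_zero isCompact_Icc
    subset_rfl (by simp [cond_apply]), (volume (Icc a b))⁻¹, ENNReal.inv_ne_top.2 hvol, ?_⟩
  exact smul_le_smul_left _ Measure.restrict_le_self

lemma exists_le_smul_volume_energy_lt {J : Set ℝ} (hJ : J.OrdConnected) (hJ' : J.Nontrivial)
    (hR : R ≠ 0) (hR' : R ≠ ⊤) (hμ : μ ∈ compactProbMeasures J) {c : ℝ≥0∞}
    (hc : energy (posLogKernel R) μ < c) :
    ∃ ν ∈ compactProbMeasures J, ∃ D : ℝ≥0∞, D ≠ ⊤ ∧ ν ≤ D • (volume : Measure ℝ) ∧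
      energy (posLogKernel R) ν < c := by
  have := hμ.1
  obtain ⟨a, ha, b, hb, hab⟩ := hJ'.exists_lt
  obtain ⟨σ, hσ, C, hC, hσC⟩ := exists_mem_compactProbMeasures_Icc_le_smul_volume hab
  have := hσ.1
  have hσab : ∀ᵐ u ∂σ, u ∈ Icc a b := mem_of_superset Measure.support_mem_ae hσ.2.2
  have hlim := tendsto_energy_smoothedMeasure hR hR' hc.ne_top hab hC hσC hσab
  obtain ⟨s, hsc, hs⟩ := ((hlim.eventually_lt_const hc).and
    (Ioc_mem_nhdsGT (zero_lt_one (α := ℝ)))).exists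
  exact ⟨smoothedMeasure μ σ s, smoothedMeasure_mem_compactProbMeasures hJ hμ
    (compactProbMeasures_mono (hJ.out ha hb) hσ) (Ioc_subset_Icc_self hs), _,
    ENNReal.mul_ne_top hC ENNReal.ofReal_ne_top,
    map_add_mul_prod_le μ hσC (measurable_const_mul (1 - s)) hs.1.ne', hsc⟩

end Smoothing

lemma minEnergy_posLogKernel_ne_top {J : Set ℝ} (hJ : J.OrdConnected) (hJ' : J.Nontrivial) {r : ℝ}
    (hr : 0 < r) : minEnergy (posLogKernel (ENNReal.ofReal r)) J ≠ ⊤ := by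
  obtain ⟨a, ha, b, hb, hab⟩ := hJ'.exists_lt
  obtain ⟨σ, hσ, C, hC, hσC⟩ := exists_mem_compactProbMeasures_Icc_le_smul_volume hab
  have := hσ.1
  exact ne_top_of_le_ne_top (ENNReal.mul_ne_top hC ENNReal.ofReal_ne_top)
    ((minEnergy_le (compactProbMeasures_mono (hJ.out ha hb) hσ)).trans
      (energy_posLogKernel_le hr hσC))

lemma measurable_measure_closedBall {X : Type*} [PseudoMetricSpace X] [SecondCountableTopology X]
    [MeasurableSpace X] [OpensMeasurableSpace X] (ρ : Measure X) [SFinite ρ] (r : ℝ) :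
    Measurable fun x => ρ (Metric.closedBall x r) :=
  measurable_measure_prodMk_left (s := {p : X × X | dist p.2 p.1 ≤ r})
    (measurableSet_le (by fun_prop) measurable_const)

lemma exists_energy_lt_ae_mem {X : Type*} [TopologicalSpace X] [HereditarilyLindelofSpace X]
    [T2Space X] [MeasurableSpace X] {κ : X × X → ℝ≥0∞} {ν : Measure X} {J : Set X}
    (hν : ν ∈ compactProbMeasures J) {A : ℕ → Set X} (hA : ∀ n, MeasurableSet (A n))
    (hmono : Monotone A) (hνA : ∀ᵐ x ∂ν, ∃ n, x ∈ A n) {c : ℝ≥0∞} (hc : energy κ ν < c) :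
    ∃ n, ∃ ν' ∈ compactProbMeasures J, ∃ D : ℝ≥0∞, D ≠ ⊤ ∧ ν' ≤ D • ν ∧ (∀ᵐ x ∂ν', x ∈ A n) ∧
      energy κ ν' < c := by
  have := hν.1
  have hmass : Tendsto (fun n => ν (A n)) atTop (𝓝 1) := by
    rw [← measure_univ (μ := ν), ← measure_congr (eventuallyEq_univ.2 (hνA.mono
      fun x hx => mem_iUnion.2 hx))]
    exact tendsto_measure_iUnion_atTop hmono
  have henergy : Tendsto (fun n => ((ν (A n))⁻¹) ^ 2 * energy κ ν) atTop (𝓝 (energy κ ν)) := by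
    have hinv : Tendsto (fun n => ((ν (A n))⁻¹) ^ 2) atTop (𝓝 1) := by
      simpa using! ((ENNReal.continuous_pow 2).tendsto _).comp (tendsto_inv_iff.2 hmass)
    simpa using ENNReal.Tendsto.mul_const hinv (Or.inl one_ne_zero)
  obtain ⟨n, hn, hn'⟩ := ((henergy.eventually_lt_const hc).and
    (hmass.eventually_const_lt zero_lt_one)).exists
  have hle : ν[|A n] ≤ (ν (A n))⁻¹ • ν := smul_le_smul_left _ Measure.restrict_le_self
  have := cond_isProbabilityMeasure hn'.ne'
  refine ⟨n, ν[|A n], mem_compactProbMeasures_of_measure_compl_eq_zero hν.2.1 hν.2.2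
    (cond_absolutelyContinuous Measure.measure_compl_support), _, ENNReal.inv_ne_top.2 hn'.ne', hle,
    ae_cond_mem (hA n), ?_⟩
  calc energy κ ν[|A n] ≤ energy κ ((ν (A n))⁻¹ • ν) := energy_mono hle
    _ < c := by rwa [energy_smul]

section LowerDensity

variable {ρ : Measure ℝ} {r : ℕ → ℝ}

/-- The points whose closed ball of radius `r k` has `ρ`-mass at least `r k / (n + 1)` for every
`k ≥ n`. These sets increase to the set of points of positive lower density along `r`. -/
def lowerDensitySet (ρ : Measure ℝ) (r : ℕ → ℝ) (n : ℕ) : Set ℝ :=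
  {x | ∀ k ≥ n, ENNReal.ofReal (r k / (n + 1)) ≤ ρ (Metric.closedBall x (r k))}

lemma measurableSet_lowerDensitySet [SFinite ρ] (n : ℕ) :
    MeasurableSet (lowerDensitySet ρ r n) := by
  simp only [lowerDensitySet, ge_iff_le, ofPred_forall]
  exact .iInter fun k => .iInter fun _ =>
    measurableSet_le measurable_const (measurable_measure_closedBall ρ (r k))

lemma monotone_lowerDensitySet (hr : ∀ k, 0 ≤ r k) : Monotone (lowerDensitySet ρ r) := by
  intro m n hmn x hx k hk
  refine le_trans ?_ (hx k (hmn.trans hk))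
  have := hr k
  gcongr

lemma eventually_ofReal_mul_le_measure_closedBall [IsFiniteMeasure ρ] (hρ : ρ ≪ volume) :
    ∀ᵐ x ∂ρ, ∃ b > 0, ∀ᶠ t in 𝓝[>] 0,
      ENNReal.ofReal (t * b) ≤ ρ (Metric.closedBall x t) := by
  filter_upwards [hρ.ae_le (Besicovitch.ae_tendsto_rnDeriv ρ volume), Measure.rnDeriv_pos hρ]
    with x hx hpos
  obtain ⟨b, hb₀, hb⟩ := ENNReal.lt_iff_exists_nnreal_btwn.1 hpos
  refine ⟨2 * b, by simpa using! hb₀, ?_⟩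
  filter_upwards [hx.eventually_const_lt hb, self_mem_nhdsWithin] with t ht ht₀
  rw [mem_Ioi] at ht₀
  rw [Real.volume_closedBall, ENNReal.lt_div_iff_mul_lt (Or.inl (by simpa))
    (Or.inl ENNReal.ofReal_ne_top), ← ENNReal.ofReal_coe_nnreal,
    ← ENNReal.ofReal_mul b.coe_nonneg] at ht
  exact (le_of_eq (by ring_nf)).trans ht.le

lemma ae_exists_mem_lowerDensitySet [IsFiniteMeasure ρ] (hρ : ρ ≪ volume)
    (hr : Tendsto r atTop (𝓝[>] 0)) (hr' : ∀ k, 0 ≤ r k) :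
    ∀ᵐ x ∂ρ, ∃ n, x ∈ lowerDensitySet ρ r n := by
  filter_upwards [eventually_ofReal_mul_le_measure_closedBall hρ] with x ⟨b, hb, hx⟩
  obtain ⟨k₀, hk₀⟩ := eventually_atTop.1 (hr.eventually hx)
  obtain ⟨n, hn, hn'⟩ := ((tendsto_one_div_add_atTop_nhds_zero_nat (𝕜 := ℝ)).eventually_le_const hb
    |>.and (eventually_ge_atTop k₀)).exists
  refine ⟨n, fun k hk => (ENNReal.ofReal_le_ofReal ?_).trans (hk₀ k (hn'.trans hk))⟩
  rw [div_eq_mul_one_div]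
  exact mul_le_mul_of_nonneg_left hn (hr' k)

end LowerDensity

section NearDiagonal

variable {ν : Measure ℝ} [IsProbabilityMeasure ν] {D : ℝ≥0∞} {r : ℝ}

lemma measure_prod_dist_le (hν : ν ≤ D • volume) :
    (ν.prod ν) {p | dist p.1 p.2 ≤ r} ≤ D * ENNReal.ofReal (2 * r) := by
  rw [Measure.prod_apply (measurableSet_le (by fun_prop) measurable_const)]
  calc ∫⁻ x, ν (Prod.mk x ⁻¹' {p | dist p.1 p.2 ≤ r}) ∂ν
      ≤ ∫⁻ _, D * ENNReal.ofReal (2 * r) ∂ν := by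
        refine lintegral_mono fun x => (hν _).trans_eq ?_
        rw [show Prod.mk x ⁻¹' {p | dist p.1 p.2 ≤ r} = Metric.closedBall x r by
          ext; simp [dist_comm], Measure.smul_apply, Real.volume_closedBall, smul_eq_mul]
    _ = D * ENNReal.ofReal (2 * r) := by simp

lemma setLIntegral_posLogKernel_le (hr : 0 < r) (hν : ν ≤ D • volume) (R : ℝ≥0∞) :
    ∫⁻ p in {p | dist p.1 p.2 ≤ r}, posLogKernel R p ∂(ν.prod ν) ≤
      D * ENNReal.ofReal (2 * r) * (eposLog (R / ENNReal.ofReal r) + 1) := by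
  calc ∫⁻ p in {p | dist p.1 p.2 ≤ r}, posLogKernel R p ∂(ν.prod ν)
      ≤ ∫⁻ p in {p | dist p.1 p.2 ≤ r}, (eposLog (R / ENNReal.ofReal r) +
          posLogKernel (ENNReal.ofReal r) p) ∂(ν.prod ν) :=
        lintegral_mono fun p => eposLog_div_le (by simpa) ENNReal.ofReal_ne_top _
    _ ≤ eposLog (R / ENNReal.ofReal r) * (ν.prod ν) {p | dist p.1 p.2 ≤ r} +
          energy (posLogKernel (ENNReal.ofReal r)) ν := by
        rw [lintegral_add_left measurable_const, setLIntegral_const]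
        gcongr
        exact setLIntegral_le_lintegral _ _
    _ ≤ eposLog (R / ENNReal.ofReal r) * (D * ENNReal.ofReal (2 * r)) +
          D * ENNReal.ofReal (2 * r) := by
        gcongr
        · exact measure_prod_dist_le hν
        · exact energy_posLogKernel_le hr hν
    _ = D * ENNReal.ofReal (2 * r) * (eposLog (R / ENNReal.ofReal r) + 1) := by ring

end NearDiagonal

section Blocks

variable {L s : ℕ → ℝ≥0∞}

/-- The weights are proportional to `(L k)⁻¹`, which minimises `∑ w k ^ 2 * L k` to
`(∑ (L k)⁻¹)⁻¹`. -/
lemma exists_weights_sum_sq_mul_le (hL : ∀ k, L k ≠ 0) (hsum : ∑' k, (L k)⁻¹ = ⊤) {c ε : ℝ≥0∞}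
    (hc : c ≠ ⊤) (hε : ε ≠ 0) (n : ℕ) :
    ∃ N > n, ∃ w : ℕ → ℝ≥0∞, ∑ k ∈ Finset.Ico n N, w k = 1 ∧
      c * ∑ k ∈ Finset.Ico n N, w k ^ 2 * L k ≤ ε := by
  have hfin (n : ℕ) : ∑ k ∈ Finset.range n, (L k)⁻¹ ≠ ⊤ :=
    ENNReal.sum_ne_top.2 fun k _ => ENNReal.inv_ne_top.2 (hL k)
  have hlim : Tendsto (fun N => ∑ k ∈ Finset.range N, (L k)⁻¹) atTop (𝓝 ⊤) :=
    hsum ▸ ENNReal.tendsto_nat_tsum _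
  obtain ⟨N, hN, hnN⟩ := ((hlim.eventually_const_lt (ENNReal.add_ne_top.2
    ⟨ENNReal.div_ne_top hc hε, hfin n⟩).lt_top).and (eventually_gt_atTop n)).exists
  set W := ∑ k ∈ Finset.Ico n N, (L k)⁻¹ with hW
  have hcW : c / ε < W := by
    rw [← Finset.sum_range_add_sum_Ico _ hnN.le, add_comm] at hN
    exact (ENNReal.add_lt_add_iff_left (hfin n)).1 hN
  have hW₀ : W ≠ 0 := (zero_le.trans_lt hcW).ne'
  have hW' : W ≠ ⊤ := ENNReal.sum_ne_top.2 fun k _ => ENNReal.inv_ne_top.2 (hL k)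
  have hw : ∑ k ∈ Finset.Ico n N, (L k)⁻¹ / W = 1 := by
    simp only [div_eq_mul_inv, ← Finset.sum_mul]
    exact ENNReal.mul_inv_cancel hW₀ hW'
  refine ⟨N, hnN, fun k => (L k)⁻¹ / W, hw, ?_⟩
  calc c * ∑ k ∈ Finset.Ico n N, ((L k)⁻¹ / W) ^ 2 * L k
      ≤ c * ∑ k ∈ Finset.Ico n N, (L k)⁻¹ / W * W⁻¹ := by
        refine mul_le_mul_right (Finset.sum_le_sum fun k _ => ?_) c
        calc ((L k)⁻¹ / W) ^ 2 * L k = (L k)⁻¹ / W * W⁻¹ * ((L k)⁻¹ * L k) := by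
              simp only [div_eq_mul_inv]; ring
          _ ≤ (L k)⁻¹ / W * W⁻¹ := mul_le_of_le_one_right' (ENNReal.inv_mul_le_one _)
    _ = c / W := by rw [← Finset.sum_mul, hw, one_mul, div_eq_mul_inv]
    _ ≤ ε := by
        rw [ENNReal.div_le_iff hW₀ hW', mul_comm,
          ← ENNReal.div_le_iff_le_mul (Or.inl hε) (Or.inr hW₀)]
        exact hcW.le

lemma exists_blocks_sum_sq_mul_le (hL : ∀ k, L k ≠ 0) (hsum : ∑' k, (L k)⁻¹ = ⊤) {Γ : ℕ → ℝ≥0∞}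
    (hΓ : ∀ n, Γ n ≠ ⊤) {ε : ℕ → ℝ≥0∞} (hε : ∀ j, ε j ≠ 0) (m : ℕ) :
    ∃ b : ℕ → ℕ, StrictMono b ∧ m ≤ b 0 ∧ ∃ w : ℕ → ℕ → ℝ≥0∞, ∀ j,
      ∑ k ∈ Finset.Ico (b j) (b (j + 1)), w j k = 1 ∧
      Γ (b j) * ∑ k ∈ Finset.Ico (b j) (b (j + 1)), w j k ^ 2 * L k ≤ ε j := by
  choose N hN w hw using fun j n => exists_weights_sum_sq_mul_le hL hsum (hΓ n) (hε j) n
  let b (j : ℕ) : ℕ := Nat.rec m N j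
  exact ⟨b, strictMono_nat_of_lt_succ fun j => hN j (b j), le_rfl, fun j => w j (b j),
    fun j => hw j (b j)⟩

lemma one_add_sum_le_prod_one_add {ι : Type*} (t : Finset ι) (s : ι → ℝ≥0∞) :
    1 + ∑ k ∈ t, s k ≤ ∏ k ∈ t, (1 + s k) := by
  classical
  induction t using Finset.induction_on with
  | empty => simp
  | insert a t ha ih =>
    rw [Finset.sum_insert ha, Finset.prod_insert ha, one_add_mul, add_left_comm, add_comm]
    gcongr
    exact le_mul_of_one_le_right' (le_self_add.trans ih)

lemma prod_one_add_sum_blocks_le {b : ℕ → ℕ} (hb : Monotone b) (s : ℕ → ℝ≥0∞) (i : ℕ) :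
    ∏ j ∈ Finset.range i, (1 + ∑ k ∈ Finset.Ico (b j) (b (j + 1)), s k) ≤
      ∏ k ∈ Finset.range (b i), (1 + s k) := by
  induction i with
  | zero => exact Finset.one_le_prod' fun _ _ => le_self_add
  | succ i ih =>
    rw [Finset.prod_range_succ, ← Finset.prod_range_mul_prod_Ico _ (hb i.le_succ)]
    gcongr
    exact one_add_sum_le_prod_one_add _ _

lemma lintegral_mul_prod_one_add_le {Y : Type*} [MeasurableSpace Y] {μ : Measure Y} {g : Y → ℝ≥0∞}
    {E : ℕ → Y → ℝ≥0∞} (hg : Measurable g) (hE : ∀ j, Measurable (E j)) {C ε : ℕ → ℝ≥0∞}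
    (hC : ∀ i y, ∏ j ∈ Finset.range i, (1 + E j y) ≤ C i)
    (hε : ∀ j, C j * ∫⁻ y, g y * E j y ∂μ ≤ ε j) (i : ℕ) :
    ∫⁻ y, g y * ∏ j ∈ Finset.range i, (1 + E j y) ∂μ ≤
      ∫⁻ y, g y ∂μ + ∑ j ∈ Finset.range i, ε j := by
  induction i with
  | zero => simp
  | succ i ih =>
    calc ∫⁻ y, g y * ∏ j ∈ Finset.range (i + 1), (1 + E j y) ∂μ
        ≤ ∫⁻ y, (g y * ∏ j ∈ Finset.range i, (1 + E j y) + C i * (g y * E i y)) ∂μ := by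
          refine lintegral_mono fun y => ?_
          rw [Finset.prod_range_succ, mul_add, mul_one, mul_add, ← mul_assoc, mul_right_comm,
            mul_comm (g y * E i y)]
          gcongr
          exact hC i y
      _ = ∫⁻ y, g y * ∏ j ∈ Finset.range i, (1 + E j y) ∂μ + C i * ∫⁻ y, g y * E i y ∂μ := by
          rw [lintegral_add_right _ (by fun_prop), lintegral_const_mul _ (by fun_prop)]
      _ ≤ ∫⁻ y, g y ∂μ + ∑ j ∈ Finset.range (i + 1), ε j := by
          rw [Finset.sum_range_succ, ← add_assoc]
          exact add_le_add ih (hε i)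

lemma exists_blocks_lintegral_mul_prod_le {Y : Type*} [MeasurableSpace Y] (μ : Measure Y)
    {e : ℕ → Y → ℝ≥0∞} (he : ∀ k, Measurable (e k)) (hs : ∀ k, s k ≠ ⊤) (hes : ∀ k y, e k y ≤ s k)
    (hL : ∀ k, L k ≠ 0) (hsum : ∑' k, (L k)⁻¹ = ⊤) {ε : ℝ≥0∞} (hε : ε ≠ 0) (m : ℕ) :
    ∃ b : ℕ → ℕ, StrictMono b ∧ m ≤ b 0 ∧ ∃ w : ℕ → ℕ → ℝ≥0∞,
      (∀ j, ∑ k ∈ Finset.Ico (b j) (b (j + 1)), w j k = 1) ∧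
      ∀ g : Y → ℝ≥0∞, Measurable g → (∀ k ≥ m, ∫⁻ y, g y * e k y ∂μ ≤ L k) → ∀ i,
        ∫⁻ y, g y * ∏ j ∈ Finset.range i,
          (1 + ∑ k ∈ Finset.Ico (b j) (b (j + 1)), w j k ^ 2 * e k y) ∂μ ≤ ∫⁻ y, g y ∂μ + ε := by
  obtain ⟨ε', hε'₀, hε'⟩ := ENNReal.exists_pos_sum_of_countable' hε ℕ
  obtain ⟨b, hb, hbm, w, hw⟩ := exists_blocks_sum_sq_mul_le hL hsum
    (Γ := fun n => ∏ k ∈ Finset.range n, (1 + s k))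
    (fun n => ENNReal.prod_ne_top fun k _ => ENNReal.add_ne_top.2 ⟨ENNReal.one_ne_top, hs k⟩)
    (fun j => (hε'₀ j).ne') m
  have hw_le (j k : ℕ) (hk : k ∈ Finset.Ico (b j) (b (j + 1))) : w j k ^ 2 ≤ 1 :=
    pow_le_one' ((Finset.single_le_sum (fun _ _ => zero_le) hk).trans_eq (hw j).1) 2
  refine ⟨b, hb, hbm, w, fun j => (hw j).1, fun g hg hgL i => ?_⟩
  refine (lintegral_mul_prod_one_add_le hg (fun j => by fun_prop)
    (C := fun i => ∏ k ∈ Finset.range (b i), (1 + s k)) (ε := ε') (fun i y => ?_) (fun j => ?_)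
    i).trans ?_
  · refine le_trans ?_ (prod_one_add_sum_blocks_le hb.monotone s i)
    gcongr with j _ k hk
    exact (mul_le_of_le_one_left' (hw_le j k hk)).trans (hes k y)
  · refine le_trans ?_ (hw j).2
    gcongr
    simp only [Finset.mul_sum, mul_left_comm (g _)]
    rw [lintegral_finsetSum _ fun k _ => by fun_prop]
    gcongr with k hk
    rw [lintegral_const_mul _ (by fun_prop)]
    gcongr
    exact hgL k (hbm.trans ((hb.monotone j.zero_le).trans (Finset.mem_Ico.1 hk).1))
  · gcongr
    exact (ENNReal.sum_le_tsum _).trans hε'.le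

end Blocks

section Independence

variable {Ω ι κ : Type*} {mΩ : MeasurableSpace Ω} {P : Measure Ω}

lemma lintegral_prod_eq_prod_lintegral_of_iIndep {m : ι → MeasurableSpace Ω} (hle : ∀ i, m i ≤ mΩ)
    (hm : iIndep m P) {S : κ → Set ι} (hS : Pairwise (Function.onFun Disjoint S))
    {F : κ → Ω → ℝ≥0∞} (hF : ∀ j, Measurable[⨆ i ∈ S j, m i] (F j)) (t : Finset κ) :
    ∫⁻ ω, ∏ j ∈ t, F j ω ∂P = ∏ j ∈ t, ∫⁻ ω, F j ω ∂P := by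
  have := hm.isProbabilityMeasure
  induction t using Finset.cons_induction with
  | empty => simp
  | cons a t ha ih =>
    have hdisj : Disjoint (S a) (⋃ j ∈ t, S j) :=
      disjoint_iUnion₂_right.2 fun j hj => hS fun haj => ha (haj ▸ hj)
    have hFt : Measurable[⨆ i ∈ ⋃ j ∈ t, S j, m i] fun ω => ∏ j ∈ t, F j ω :=
      Finset.measurable_fun_prod t fun j hj =>
        (hF j).mono (biSup_mono fun _ hi => mem_biUnion hj hi) le_rfl
    simp only [Finset.prod_cons]
    rw [lintegral_mul_eq_lintegral_mul_lintegral_of_independent_measurableSpace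
      (iSup₂_le fun i _ => hle i) (iSup₂_le fun i _ => hle i)
      (indep_iSup_of_disjoint hle hm hdisj) (hF a) hFt, ih]

lemma lintegral_sum_mul_sum_le {Y Z : ι → Ω → ℝ≥0∞} (hY : ∀ k, Measurable (Y k))
    (hZ : ∀ k, Measurable (Z k)) {s : Finset ι} {w e : ι → ℝ≥0∞} (hw : ∑ k ∈ s, w k = 1)
    (hdiag : ∀ k ∈ s, ∫⁻ ω, Y k ω * Z k ω ∂P ≤ e k)
    (hoff : ∀ k ∈ s, ∀ l ∈ s, k ≠ l → ∫⁻ ω, Y k ω * Z l ω ∂P ≤ 1) :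
    ∫⁻ ω, (∑ k ∈ s, w k * Y k ω) * ∑ k ∈ s, w k * Z k ω ∂P ≤ 1 + ∑ k ∈ s, w k ^ 2 * e k := by
  classical
  have hpair (k : ι) (hk : k ∈ s) (l : ι) (hl : l ∈ s) :
      ∫⁻ ω, Y k ω * Z l ω ∂P ≤ 1 + if k = l then e k else 0 := by
    rcases eq_or_ne k l with rfl | hkl
    · exact (hdiag k hk).trans (by simp)
    · exact (hoff k hk l hl hkl).trans le_self_add
  calc ∫⁻ ω, (∑ k ∈ s, w k * Y k ω) * ∑ k ∈ s, w k * Z k ω ∂P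
      = ∑ k ∈ s, ∑ l ∈ s, w k * w l * ∫⁻ ω, Y k ω * Z l ω ∂P := by
        simp only [Finset.sum_mul_sum, mul_mul_mul_comm (w _) (Y _ _)]
        rw [lintegral_finsetSum _ fun k _ => by fun_prop]
        refine Finset.sum_congr rfl fun k _ => ?_
        rw [lintegral_finsetSum _ fun l _ => by fun_prop]
        exact Finset.sum_congr rfl fun l _ => lintegral_const_mul _ (by fun_prop)
    _ ≤ ∑ k ∈ s, ∑ l ∈ s, w k * w l * (1 + if k = l then e k else 0) := by
        gcongr with k hk l hl
        exact hpair k hk l hl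
    _ = 1 + ∑ k ∈ s, w k ^ 2 * e k := by
        simp only [mul_add, mul_one, Finset.sum_add_distrib, ← Finset.sum_mul_sum, hw, mul_ite,
          mul_zero, Finset.sum_ite_eq]
        congr 1
        exact Finset.sum_congr rfl fun k hk => by rw [if_pos hk, sq]

end Independence

section Cascade

variable {Ω X : Type*} {mΩ : MeasurableSpace Ω} {P : Measure Ω} {b : ℕ → ℕ} {w : ℕ → ℕ → ℝ≥0∞}
  {u : ℕ → Ω → X → ℝ≥0∞}

/-- The multiplicative cascade: the product over `j < i` of the averages, with weights `w j`, of the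
densities `u k` with `k` in the block `b j ≤ k < b (j + 1)`. -/
noncomputable def cascade (b : ℕ → ℕ) (w : ℕ → ℕ → ℝ≥0∞) (u : ℕ → X → ℝ≥0∞) (i : ℕ) (x : X) :
    ℝ≥0∞ :=
  ∏ j ∈ Finset.range i, ∑ k ∈ Finset.Ico (b j) (b (j + 1)), w j k * u k x

/-- The set carrying the cascade of densities `u k` that are supported in the sets `B k`: the points
covered by at least one `B k` from each of the first `i` blocks. -/
def cascadeSet (b : ℕ → ℕ) (B : ℕ → Set X) (i : ℕ) : Set X :=
  ⋂ j ∈ Finset.range i, ⋃ k ∈ Finset.Ico (b j) (b (j + 1)), B k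

lemma mem_cascadeSet_of_cascade_ne_zero {u : ℕ → X → ℝ≥0∞} {B : ℕ → Set X}
    (hu : ∀ k x, u k x ≠ 0 → x ∈ B k) {i : ℕ} {x : X} (h : cascade b w u i x ≠ 0) :
    x ∈ cascadeSet b B i := by
  refine mem_iInter₂.2 fun j hj => ?_
  obtain ⟨k, hk, hkx⟩ := Finset.exists_ne_zero_of_sum_ne_zero (Finset.prod_ne_zero_iff.1 h j hj)
  exact mem_biUnion hk (hu k x (right_ne_zero_of_mul hkx))

lemma isClosed_cascadeSet [TopologicalSpace X] {B : ℕ → Set X} (hB : ∀ k, IsClosed (B k)) (i : ℕ) :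
    IsClosed (cascadeSet b B i) :=
  isClosed_biInter fun _ _ => isClosed_biUnion_finset fun k _ => hB k

lemma antitone_cascadeSet (b : ℕ → ℕ) (B : ℕ → Set X) : Antitone (cascadeSet b B) :=
  fun _ _ hij => biInter_subset_biInter_left (Finset.range_mono hij)

lemma iInter_cascadeSet_subset_limsup (hb : StrictMono b) (B : ℕ → Set X) :
    ⋂ i, cascadeSet b B i ⊆ limsup B atTop := by
  intro x hx
  rw [mem_limsup_iff_frequently_mem, frequently_atTop]
  intro n
  obtain ⟨k, hk, hxk⟩ := mem_iUnion₂.1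
    (mem_iInter₂.1 (mem_iInter.1 hx (n + 1)) n (Finset.self_mem_range_succ n))
  exact ⟨k, hb.le_apply.trans (Finset.mem_Ico.1 hk).1, hxk⟩

lemma lintegral_prod_blocks_eq_prod_lintegral {β : ℕ → Type*} [∀ k, MeasurableSpace (β k)]
    {c : ∀ k, Ω → β k} (hc : iIndepFun c P) (hc' : ∀ k, Measurable (c k)) (hb : Monotone b)
    {F : ℕ → Ω → ℝ≥0∞}
    (hF : ∀ j, Measurable[⨆ k ∈ Ico (b j) (b (j + 1)), MeasurableSpace.comap (c k) inferInstance]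
      (F j)) (i : ℕ) :
    ∫⁻ ω, ∏ j ∈ Finset.range i, F j ω ∂P = ∏ j ∈ Finset.range i, ∫⁻ ω, F j ω ∂P :=
  lintegral_prod_eq_prod_lintegral_of_iIndep (fun k => (hc' k).comap_le) hc
    hb.pairwise_disjoint_on_Ico_succ hF _

lemma measurable_blockAverage (w : ℕ → ℕ → ℝ≥0∞) (b : ℕ → ℕ) (j : ℕ) (x : X) :
    Measurable[⨆ k ∈ Ico (b j) (b (j + 1)), MeasurableSpace.comap (u k) inferInstance]
      fun ω => ∑ k ∈ Finset.Ico (b j) (b (j + 1)), w j k * u k ω x := by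
  refine Finset.measurable_fun_sum _ fun k hk => Measurable.const_mul ?_ _
  exact ((measurable_pi_apply x).comp (comap_measurable (u k))).mono
    (le_iSup₂_of_le k (Finset.mem_Ico.1 hk) le_rfl) le_rfl

lemma lintegral_cascade_eq_one (hu : iIndepFun u P) (hu' : ∀ k, Measurable (u k)) (hb : Monotone b)
    (hw : ∀ j, ∑ k ∈ Finset.Ico (b j) (b (j + 1)), w j k = 1) {x : X}
    (hx : ∀ k ≥ b 0, ∫⁻ ω, u k ω x ∂P = 1) (i : ℕ) :
    ∫⁻ ω, cascade b w (u · ω) i x ∂P = 1 := by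
  have hux (k : ℕ) : Measurable fun ω => u k ω x := measurable_pi_iff.1 (hu' k) x
  have hblock (j : ℕ) : ∫⁻ ω, ∑ k ∈ Finset.Ico (b j) (b (j + 1)), w j k * u k ω x ∂P = 1 := by
    rw [lintegral_finsetSum _ fun k _ => by fun_prop, ← hw j]
    refine Finset.sum_congr rfl fun k hk => ?_
    rw [lintegral_const_mul _ (hux k), hx k ((hb j.zero_le).trans (Finset.mem_Ico.1 hk).1), mul_one]
  unfold cascade
  rw [lintegral_prod_blocks_eq_prod_lintegral hu hu' hb
    (fun j => measurable_blockAverage w b j x), Finset.prod_congr rfl fun j _ => hblock j,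
    Finset.prod_const_one]

lemma lintegral_cascade_mul_cascade_le (hu : iIndepFun u P) (hu' : ∀ k, Measurable (u k))
    (hb : Monotone b) (hw : ∀ j, ∑ k ∈ Finset.Ico (b j) (b (j + 1)), w j k = 1) {x y : X}
    (hx : ∀ k ≥ b 0, ∫⁻ ω, u k ω x ∂P = 1) (hy : ∀ k ≥ b 0, ∫⁻ ω, u k ω y ∂P = 1) {e : ℕ → ℝ≥0∞}
    (hxy : ∀ k ≥ b 0, ∫⁻ ω, u k ω x * u k ω y ∂P ≤ e k) (i : ℕ) :
    ∫⁻ ω, cascade b w (u · ω) i x * cascade b w (u · ω) i y ∂P ≤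
      ∏ j ∈ Finset.range i, (1 + ∑ k ∈ Finset.Ico (b j) (b (j + 1)), w j k ^ 2 * e k) := by
  have hux (x : X) (k : ℕ) : Measurable fun ω => u k ω x := measurable_pi_iff.1 (hu' k) x
  have hge {j k : ℕ} (hk : k ∈ Finset.Ico (b j) (b (j + 1))) : b 0 ≤ k :=
    (hb j.zero_le).trans (Finset.mem_Ico.1 hk).1
  simp only [cascade, ← Finset.prod_mul_distrib]
  refine (lintegral_prod_blocks_eq_prod_lintegral hu hu' hb (fun j =>
    (measurable_blockAverage w b j x).mul (measurable_blockAverage w b j y)) i).trans_le ?_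
  gcongr with j
  refine lintegral_sum_mul_sum_le (hux x) (hux y) (hw j) (fun k hk => hxy k (hge hk)) ?_
  intro k hk l hl hkl
  rw [lintegral_mul_eq_lintegral_mul_lintegral_of_indepFun'' (hux x k).aemeasurable
    (hux y l).aemeasurable ((hu.indepFun hkl).comp (measurable_pi_apply x) (measurable_pi_apply y)),
    hx k (hge hk), hy l (hge hl), mul_one]

lemma measurable_cascade [MeasurableSpace X] {u : ℕ → X → ℝ≥0∞} (hu : ∀ k, Measurable (u k))
    (b : ℕ → ℕ) (w : ℕ → ℕ → ℝ≥0∞) (i : ℕ) : Measurable (cascade b w u i) := by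
  unfold cascade
  fun_prop

section Moments

variable [MeasurableSpace X] {ν : Measure X} [SFinite ν]

lemma measurable_cascade_uncurry (hu : ∀ k, Measurable fun p : Ω × X => u k p.1 p.2)
    (b : ℕ → ℕ) (w : ℕ → ℕ → ℝ≥0∞) (i : ℕ) :
    Measurable fun p : Ω × X => cascade b w (u · p.1) i p.2 := by
  unfold cascade
  fun_prop

lemma measurable_mul_cascade_mul_cascade {κ : X × X → ℝ≥0∞} (hκ : Measurable κ)
    (hu : ∀ k, Measurable fun p : Ω × X => u k p.1 p.2) (b : ℕ → ℕ) (w : ℕ → ℕ → ℝ≥0∞) (i : ℕ) :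
    Measurable fun q : Ω × X × X =>
      κ q.2 * (cascade b w (u · q.1) i q.2.1 * cascade b w (u · q.1) i q.2.2) := by
  unfold cascade
  fun_prop

lemma measurable_energy_withDensity_cascade {κ : X × X → ℝ≥0∞} (hκ : Measurable κ)
    (hu : ∀ k, Measurable fun p : Ω × X => u k p.1 p.2) (b : ℕ → ℕ) (w : ℕ → ℕ → ℝ≥0∞) (i : ℕ) :
    Measurable fun ω => energy κ (ν.withDensity (cascade b w (u · ω) i)) := by
  have hWω (ω : Ω) : Measurable (cascade b w (u · ω) i) := measurable_cascade
    (fun k => (hu k).comp measurable_prodMk_left) b w i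
  have henergy (ω : Ω) := energy_withDensity (μ := ν) hκ (hWω ω)
  simp only [henergy]
  unfold energy
  exact (measurable_mul_cascade_mul_cascade hκ hu b w i).lintegral_prod_right'

lemma measurable_withDensity_cascade_univ (hu : ∀ k, Measurable fun p : Ω × X => u k p.1 p.2)
    (b : ℕ → ℕ) (w : ℕ → ℕ → ℝ≥0∞) (i : ℕ) :
    Measurable fun ω => ν.withDensity (cascade b w (u · ω) i) univ := by
  simp only [withDensity_apply _ MeasurableSet.univ, Measure.restrict_univ]
  exact (measurable_cascade_uncurry hu b w i).lintegral_prod_right'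

lemma lintegral_withDensity_cascade_univ [IsProbabilityMeasure ν]
    (hu : iIndepFun u P) (hu' : ∀ k, Measurable fun p : Ω × X => u k p.1 p.2) (hb : Monotone b)
    (hw : ∀ j, ∑ k ∈ Finset.Ico (b j) (b (j + 1)), w j k = 1)
    (hux : ∀ᵐ x ∂ν, ∀ k ≥ b 0, ∫⁻ ω, u k ω x ∂P = 1) (i : ℕ) :
    ∫⁻ ω, ν.withDensity (cascade b w (u · ω) i) univ ∂P = 1 := by
  simp only [withDensity_apply _ MeasurableSet.univ, Measure.restrict_univ]
  have := hu.isProbabilityMeasure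
  have hcascade : ∀ᵐ x ∂ν, ∫⁻ ω, cascade b w (u · ω) i x ∂P = 1 := hux.mono fun x hx =>
    lintegral_cascade_eq_one hu (fun k => measurable_pi_iff.2 fun x =>
      (hu' k).comp measurable_prodMk_right) hb hw hx i
  rw [lintegral_lintegral_swap (measurable_cascade_uncurry hu' b w i).aemeasurable,
    lintegral_congr_ae hcascade, lintegral_one, measure_univ]

lemma lintegral_energy_withDensity_cascade_le {κ : X × X → ℝ≥0∞} (hκ : Measurable κ)
    (hu : iIndepFun u P) (hu' : ∀ k, Measurable fun p : Ω × X => u k p.1 p.2) (hb : Monotone b)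
    (hw : ∀ j, ∑ k ∈ Finset.Ico (b j) (b (j + 1)), w j k = 1)
    (hux : ∀ᵐ x ∂ν, ∀ k ≥ b 0, ∫⁻ ω, u k ω x ∂P = 1) {e : ℕ → X × X → ℝ≥0∞}
    (huxy : ∀ᵐ p ∂(ν.prod ν), ∀ k ≥ b 0, ∫⁻ ω, u k ω p.1 * u k ω p.2 ∂P ≤ e k p) (i : ℕ) :
    ∫⁻ ω, energy κ (ν.withDensity (cascade b w (u · ω) i)) ∂P ≤
      ∫⁻ p, κ p * ∏ j ∈ Finset.range i,
        (1 + ∑ k ∈ Finset.Ico (b j) (b (j + 1)), w j k ^ 2 * e k p) ∂(ν.prod ν) := by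
  have := hu.isProbabilityMeasure
  have hWω (ω : Ω) : Measurable (cascade b w (u · ω) i) := measurable_cascade
    (fun k => (hu' k).comp measurable_prodMk_left) b w i
  have hWx (x : X) : Measurable fun ω => cascade b w (u · ω) i x :=
    measurable_cascade_uncurry hu' b w i |>.comp measurable_prodMk_right
  have hcascade : ∀ᵐ p ∂(ν.prod ν),
      ∫⁻ ω, κ p * (cascade b w (u · ω) i p.1 * cascade b w (u · ω) i p.2) ∂P ≤
        κ p * ∏ j ∈ Finset.range i,
          (1 + ∑ k ∈ Finset.Ico (b j) (b (j + 1)), w j k ^ 2 * e k p) := by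
    have hux₁ := (Measure.quasiMeasurePreserving_fst (μ := ν) (ν := ν)).ae hux
    have hux₂ := (Measure.quasiMeasurePreserving_snd (μ := ν) (ν := ν)).ae hux
    refine (hux₁.and (hux₂.and huxy)).mono fun p ⟨hx, hy, hxy⟩ => ?_
    rw [lintegral_const_mul _ (by fun_prop)]
    gcongr
    exact lintegral_cascade_mul_cascade_le hu (fun k => measurable_pi_iff.2 fun x =>
      (hu' k).comp measurable_prodMk_right) hb hw hx hy hxy i
  calc ∫⁻ ω, energy κ (ν.withDensity (cascade b w (u · ω) i)) ∂P
      = ∫⁻ ω, ∫⁻ p, κ p * (cascade b w (u · ω) i p.1 * cascade b w (u · ω) i p.2)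
          ∂(ν.prod ν) ∂P := lintegral_congr fun ω => energy_withDensity hκ (hWω ω)
    _ = ∫⁻ p, ∫⁻ ω, κ p * (cascade b w (u · ω) i p.1 * cascade b w (u · ω) i p.2) ∂P
          ∂(ν.prod ν) :=
        lintegral_lintegral_swap (measurable_mul_cascade_mul_cascade hκ hu' b w i).aemeasurable
    _ ≤ _ := lintegral_mono_ae hcascade

end Moments

end Cascade

section SecondMoment

variable {Ω X : Type*} {mΩ : MeasurableSpace Ω} {P : Measure Ω}

lemma measure_setOf_eventually_mem_le {B : ℕ → Set Ω} {η : ℝ≥0∞} (h : ∀ i, P (B i) ≤ η) :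
    P {ω | ∀ᶠ i in atTop, ω ∈ B i} ≤ η := by
  have hmono : Monotone fun n => ⋂ i ≥ n, B i := fun n n' hn =>
    biInter_subset_biInter_left fun i hi => hn.trans hi
  have hliminf : {ω | ∀ᶠ i in atTop, ω ∈ B i} = ⋃ n, ⋂ i ≥ n, B i := by
    ext ω
    simp only [eventually_atTop, mem_ofPred_eq, mem_iUnion, mem_iInter]
  rw [hliminf, hmono.measure_iUnion]
  exact iSup_le fun n => (measure_mono (biInter_subset_of_mem (le_refl n))).trans (h n)

lemma two_mul_le_sq_add_one {m : ℝ≥0∞} (hm : m ≠ ⊤) : 2 * m ≤ m ^ 2 + 1 := by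
  lift m to ℝ≥0 using hm
  exact_mod_cast (by simpa using two_mul_le_add_sq m 1 : 2 * m ≤ m ^ 2 + 1)

lemma two_mul_add_quarter_le_sq_add_one {m : ℝ≥0∞} (hm : m ≤ 1 / 2) :
    2 * m + 1 / 4 ≤ m ^ 2 + 1 := by
  lift m to ℝ≥0 using ne_top_of_le_ne_top (by simp) hm
  have hm' : m ≤ 1 / 2 := by
    rw [← ENNReal.coe_le_coe]
    simpa using hm
  have : 2 * m + 1 / 4 ≤ m ^ 2 + 1 := by
    rw [← NNReal.coe_le_coe] at hm' ⊢
    push_cast at hm' ⊢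
    nlinarith
  rw [← ENNReal.coe_le_coe] at this
  simpa using this

lemma mul_two_mul_le {V M E : ℝ≥0∞} (hM : M ≠ ⊤) (hVE : V * M ^ 2 ≤ E) :
    V * (2 * M) ≤ E + V :=
  calc V * (2 * M) ≤ V * (M ^ 2 + 1) := by gcongr; exact two_mul_le_sq_add_one hM
    _ = V * M ^ 2 + V := by rw [mul_add, mul_one]
    _ ≤ E + V := by gcongr

lemma mul_two_mul_add_two_mul_add_le {V M E η : ℝ≥0∞} (hVE : M ≠ ⊤ → V * M ^ 2 ≤ E)
    (hη : η ≤ 1 / 4) (h : ¬(1 / 2 ≤ M ∧ M ≠ ⊤ ∧ E ≤ V * M ^ 2 + η)) :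
    V * (2 * M) + 2 * M + η ≤ E + V + (M ^ 2 + 1) := by
  rcases eq_or_ne M ⊤ with rfl | hM
  · simp
  rcases le_or_gt M (1 / 2) with hle | hgt
  · calc V * (2 * M) + 2 * M + η = V * (2 * M) + (2 * M + η) := add_assoc ..
      _ ≤ V * (2 * M) + (2 * M + 1 / 4) := by gcongr
      _ ≤ E + V + (M ^ 2 + 1) :=
        add_le_add (mul_two_mul_le hM (hVE hM)) (two_mul_add_quarter_le_sq_add_one hle)
  · have hE : V * M ^ 2 + η ≤ E := le_of_not_ge fun hE => h ⟨hgt.le, hM, hE⟩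
    calc V * (2 * M) + 2 * M + η
        ≤ (V * M ^ 2 + V) + (M ^ 2 + 1) + η := by
          gcongr
          exacts [mul_two_mul_le hM le_rfl, two_mul_le_sq_add_one hM]
      _ = (V * M ^ 2 + η) + V + (M ^ 2 + 1) := by ring
      _ ≤ E + V + (M ^ 2 + 1) := by gcongr

/-- Markov's inequality for
`E + V + M² + 1 - 2VM - 2M = (E - VM²) + V(M - 1)² + (M - 1)²`, a sum of nonnegative terms with mean
at most `3ε`. -/
lemma mul_measure_le_of_moments [IsProbabilityMeasure P] {M E : Ω → ℝ≥0∞} (hM : Measurable M)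
    (hE : Measurable E) {V ε η : ℝ≥0∞} (hV : V ≠ ⊤) (hVE : ∀ ω, M ω ≠ ⊤ → V * M ω ^ 2 ≤ E ω)
    (hM₁ : ∫⁻ ω, M ω ∂P = 1) (hM₂ : ∫⁻ ω, M ω ^ 2 ∂P ≤ 1 + ε) (hE₁ : ∫⁻ ω, E ω ∂P ≤ V + 2 * ε)
    (hη : η ≤ 1 / 4) :
    η * P {ω | ¬(1 / 2 ≤ M ω ∧ M ω ≠ ⊤ ∧ E ω ≤ V * M ω ^ 2 + η)} ≤ 3 * ε := by
  have hle (ω : Ω) : V * (2 * M ω) + 2 * M ω ≤ E ω + V + (M ω ^ 2 + 1) := by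
    rcases eq_or_ne (M ω) ⊤ with h | h
    · simp [h]
    · exact add_le_add (mul_two_mul_le h (hVE ω h)) (two_mul_le_sq_add_one h)
  have hmarkov := lintegral_add_mul_meas_add_le_le_lintegral (μ := P) (ae_of_all P hle)
    (by fun_prop) η
  have hf : ∫⁻ ω, (V * (2 * M ω) + 2 * M ω) ∂P = 2 * V + 2 := by
    rw [lintegral_add_left (by fun_prop), lintegral_const_mul _ (by fun_prop),
      lintegral_const_mul _ hM, hM₁, mul_one, mul_comm]
  have hg : ∫⁻ ω, (E ω + V + (M ω ^ 2 + 1)) ∂P ≤ 2 * V + 2 + 3 * ε := by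
    rw [lintegral_add_left (by fun_prop), lintegral_add_left hE, lintegral_add_left (by fun_prop)]
    simp only [lintegral_const, measure_univ, mul_one]
    calc _ ≤ V + 2 * ε + V + (1 + ε + 1) := by gcongr
      _ = 2 * V + 2 + 3 * ε := by ring
  have hsub : P {ω | ¬(1 / 2 ≤ M ω ∧ M ω ≠ ⊤ ∧ E ω ≤ V * M ω ^ 2 + η)} ≤
      P {ω | V * (2 * M ω) + 2 * M ω + η ≤ E ω + V + (M ω ^ 2 + 1)} :=
    measure_mono fun ω => mul_two_mul_add_two_mul_add_le (hVE ω) hη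
  have hfin : 2 * V + 2 ≠ ⊤ := by finiteness
  refine (ENNReal.add_le_add_iff_left hfin).1 ?_
  calc 2 * V + 2 + η * P {ω | ¬(1 / 2 ≤ M ω ∧ M ω ≠ ⊤ ∧ E ω ≤ V * M ω ^ 2 + η)}
      ≤ 2 * V + 2 + η * P {ω | V * (2 * M ω) + 2 * M ω + η ≤ E ω + V + (M ω ^ 2 + 1)} := by
        gcongr
    _ ≤ ∫⁻ ω, (E ω + V + (M ω ^ 2 + 1)) ∂P := hf ▸ hmarkov
    _ ≤ 2 * V + 2 + 3 * ε := hg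

end SecondMoment

section LimsupEnergy

variable {Ω X : Type*} {mΩ : MeasurableSpace Ω} {P : Measure Ω} [TopologicalSpace X]
  [MeasurableSpace X] {κ : X × X → ℝ≥0∞} {J : Set X} {ν : Measure X} {b : ℕ → ℕ}
  {w : ℕ → ℕ → ℝ≥0∞} {i : ℕ}

lemma exists_mem_compactProbMeasures_energy_le [T2Space X] {μ : Measure X} {K : Set X}
    (hK : IsCompact K) (hμK : μ Kᶜ = 0) {V η : ℝ≥0∞} (hμ : 1 / 2 ≤ μ univ) (hμ' : μ univ ≠ ⊤)
    (h : energy κ μ ≤ V * μ univ ^ 2 + η) :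
    ∃ μ' ∈ compactProbMeasures K, energy κ μ' ≤ V + 4 * η := by
  have hμ₀ : μ univ ≠ 0 := fun h₀ => by simp [h₀] at hμ
  have : IsFiniteMeasure μ := ⟨hμ'.lt_top⟩
  have : NeZero μ := ⟨fun h₀ => hμ₀ (by simp [h₀])⟩
  have : IsProbabilityMeasure ((μ univ)⁻¹ • μ) := isProbabilityMeasureSMul
  have hsq : (μ univ)⁻¹ ^ 2 ≤ 4 := calc
    (μ univ)⁻¹ ^ 2 ≤ (1 / 2)⁻¹ ^ 2 := by gcongr
    _ = 4 := by norm_num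
  refine ⟨(μ univ)⁻¹ • μ, mem_compactProbMeasures_of_measure_compl_eq_zero hK subset_rfl
    (by simp [hμK]), ?_⟩
  calc energy κ ((μ univ)⁻¹ • μ) = (μ univ)⁻¹ ^ 2 * energy κ μ := energy_smul _
    _ ≤ (μ univ)⁻¹ ^ 2 * (V * μ univ ^ 2 + η) := by gcongr
    _ = V * ((μ univ)⁻¹ * μ univ) ^ 2 + (μ univ)⁻¹ ^ 2 * η := by ring
    _ ≤ V + 4 * η := by
      rw [ENNReal.inv_mul_cancel hμ₀ hμ', one_pow, mul_one]
      gcongr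

lemma withDensity_cascade_compl_eq_zero [HereditarilyLindelofSpace X] {u : ℕ → X → ℝ≥0∞}
    {B : ℕ → Set X} (hu : ∀ k, Measurable (u k)) (huB : ∀ k x, u k x ≠ 0 → x ∈ B k) :
    ν.withDensity (cascade b w u i) (ν.support ∩ cascadeSet b B i)ᶜ = 0 := by
  rw [withDensity_apply_eq_zero (measurable_cascade hu b w i)]
  refine measure_mono_null (t := ν.supportᶜ) ?_ Measure.measure_compl_support
  rintro x ⟨hx, hx'⟩ hxν
  exact hx' ⟨hxν, mem_cascadeSet_of_cascade_ne_zero huB hx⟩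

variable [MetrizableSpace X] [SecondCountableTopology X]
  {u : ℕ → Ω → X → ℝ≥0∞} {B : ℕ → Ω → Set X} {e : ℕ → X × X → ℝ≥0∞} {ε η : ℝ≥0∞}

lemma mul_measure_not_exists_energy_le_cascadeSet (hκ : Measurable κ) (hV : minEnergy κ J ≠ ⊤)
    (hν : ν ∈ compactProbMeasures J) (hνV : energy κ ν ≤ minEnergy κ J + ε) (hη : η ≤ 1 / 4)
    (hu : iIndepFun u P) (hu' : ∀ k, Measurable fun p : Ω × X => u k p.1 p.2)
    (hux : ∀ᵐ x ∂ν, ∀ k ≥ b 0, ∫⁻ ω, u k ω x ∂P = 1)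
    (huxy : ∀ᵐ p ∂(ν.prod ν), ∀ k ≥ b 0, ∫⁻ ω, u k ω p.1 * u k ω p.2 ∂P ≤ e k p)
    (hB : ∀ k ω, IsClosed (B k ω)) (huB : ∀ k ω x, u k ω x ≠ 0 → x ∈ B k ω) (hb : Monotone b)
    (hw : ∀ j, ∑ k ∈ Finset.Ico (b j) (b (j + 1)), w j k = 1)
    (hmass : ∫⁻ p, ∏ j ∈ Finset.range i,
      (1 + ∑ k ∈ Finset.Ico (b j) (b (j + 1)), w j k ^ 2 * e k p) ∂(ν.prod ν) ≤ 1 + ε)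
    (henergy : ∫⁻ p, κ p * ∏ j ∈ Finset.range i,
      (1 + ∑ k ∈ Finset.Ico (b j) (b (j + 1)), w j k ^ 2 * e k p) ∂(ν.prod ν) ≤
        energy κ ν + ε) :
    η * P {ω | ¬∃ μ ∈ compactProbMeasures (ν.support ∩ cascadeSet b (B · ω) i),
      energy κ μ ≤ minEnergy κ J + 4 * η} ≤ 3 * ε := by
  have := hu.isProbabilityMeasure
  obtain ⟨_, hK, hKJ⟩ := hν
  let μ (ω : Ω) : Measure X := ν.withDensity (cascade b w (u · ω) i)
  have hC (ω : Ω) : IsCompact (ν.support ∩ cascadeSet b (B · ω) i) :=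
    hK.inter_right (isClosed_cascadeSet (hB · ω) i)
  have hμC (ω : Ω) : μ ω (ν.support ∩ cascadeSet b (B · ω) i)ᶜ = 0 :=
    withDensity_cascade_compl_eq_zero (fun k => (hu' k).comp measurable_prodMk_left) (huB · ω)
  have hVμ (ω : Ω) (h : μ ω univ ≠ ⊤) : minEnergy κ J * μ ω univ ^ 2 ≤ energy κ (μ ω) :=
    have : IsFiniteMeasure (μ ω) := ⟨h.lt_top⟩
    minEnergy_mul_sq_le (hC ω) (inter_subset_left.trans hKJ) (hμC ω)
  have hM₂ : ∫⁻ ω, μ ω univ ^ 2 ∂P ≤ 1 + ε := by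
    simp only [μ, ← energy_one]
    exact (lintegral_energy_withDensity_cascade_le measurable_const hu hu' hb hw hux huxy i).trans
      (by simpa only [one_mul] using hmass)
  have hE : ∫⁻ ω, energy κ (μ ω) ∂P ≤ minEnergy κ J + 2 * ε := calc
    _ ≤ energy κ ν + ε :=
      (lintegral_energy_withDensity_cascade_le hκ hu hu' hb hw hux huxy i).trans henergy
    _ ≤ minEnergy κ J + ε + ε := by gcongr
    _ = minEnergy κ J + 2 * ε := by ring
  refine le_trans ?_ (mul_measure_le_of_moments (measurable_withDensity_cascade_univ hu' b w i)
    (measurable_energy_withDensity_cascade hκ hu' b w i) hV hVμ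
    (lintegral_withDensity_cascade_univ hu hu' hb hw hux i) hM₂ hE hη)
  gcongr with ω
  exact fun ⟨h, h', hle⟩ => exists_mem_compactProbMeasures_energy_le (hC ω) (hμC ω) h h' hle

lemma mul_measure_not_exists_energy_le [BorelSpace X] (hκ : Continuous κ) (hV : minEnergy κ J ≠ ⊤)
    (hν : ν ∈ compactProbMeasures J) (hνV : energy κ ν ≤ minEnergy κ J + ε) (hε : ε ≠ 0)
    (hη : η ≤ 1 / 4) (hu : iIndepFun u P) (hu' : ∀ k, Measurable fun p : Ω × X => u k p.1 p.2)
    {m : ℕ} (hux : ∀ᵐ x ∂ν, ∀ k ≥ m, ∫⁻ ω, u k ω x ∂P = 1)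
    (huxy : ∀ᵐ p ∂(ν.prod ν), ∀ k ≥ m, ∫⁻ ω, u k ω p.1 * u k ω p.2 ∂P ≤ e k p)
    (hB : ∀ k ω, IsClosed (B k ω)) (huB : ∀ k ω x, u k ω x ≠ 0 → x ∈ B k ω)
    (he : ∀ k, Measurable (e k)) {s L : ℕ → ℝ≥0∞} (hs : ∀ k, s k ≠ ⊤) (hes : ∀ k p, e k p ≤ s k)
    (hL : ∀ k, L k ≠ 0) (hsum : ∑' k, (L k)⁻¹ = ⊤)
    (heL : ∀ k ≥ m, ∫⁻ p, e k p ∂(ν.prod ν) ≤ L k)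
    (hκL : ∀ k ≥ m, ∫⁻ p, κ p * e k p ∂(ν.prod ν) ≤ L k) :
    η * P {ω | ¬∃ μ ∈ compactProbMeasures (limsup (B · ω) atTop ∩ J),
      energy κ μ ≤ minEnergy κ J + 4 * η} ≤ 3 * ε := by
  obtain ⟨b, hb, hmb, w, hw, hprod⟩ :=
    exists_blocks_lintegral_mul_prod_le (ν.prod ν) he hs hes hL hsum hε m
  have hge {k : ℕ} (hk : k ≥ b 0) : k ≥ m := hmb.trans hk
  obtain ⟨_, hK, hKJ⟩ := id hν
  have hblock (i : ℕ) := mul_measure_not_exists_energy_le_cascadeSet hκ.measurable hV hν hνV hη hu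
    hu' (hux.mono fun x hx k hk => hx k (hge hk)) (huxy.mono fun p hp k hk => hp k (hge hk)) hB huB
    hb.monotone hw (i := i)
    (by simpa using hprod 1 measurable_const (by simpa using heL) i)
    (hprod κ hκ.measurable hκL i)
  refine le_trans ?_ (measure_setOf_eventually_mem_le (P := η • P) hblock)
  rw [Measure.smul_apply, smul_eq_mul]
  gcongr with ω
  contrapose
  intro h
  obtain ⟨μ, hμ, hμV⟩ := exists_energy_le_iInter hκ (minEnergy κ J + 4 * η)
    (fun i => hK.inter_right (isClosed_cascadeSet (hB · ω) i))
    (fun i j hij => inter_subset_inter_right _ (antitone_cascadeSet b (B · ω) hij))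
    (by simpa only [mem_ofPred_eq, not_eventually, not_not] using h)
  refine ⟨μ, compactProbMeasures_mono ?_ hμ, hμV⟩
  rw [← inter_iInter, inter_comm]
  exact inter_subset_inter (iInter_cascadeSet_subset_limsup hb _) hKJ

end LimsupEnergy

section RandomBalls

variable {X : Type*} [PseudoMetricSpace X] [MeasurableSpace X]
  {ρ : Measure X} {r : ℝ} {δ : ℝ≥0∞} {x y z : X}

/-- The indicator of the ball of radius `r` centred at `z`, as a function of `x`, weighted so that
its mean over a centre `z` with law `ρ` is one for every `x`. -/
noncomputable def ballDensity (ρ : Measure X) (r : ℝ) (z x : X) : ℝ≥0∞ :=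
  (Metric.closedBall x r).indicator (fun _ => (ρ (Metric.closedBall x r))⁻¹) z

lemma mem_closedBall_of_ballDensity_ne_zero (h : ballDensity ρ r z x ≠ 0) :
    x ∈ Metric.closedBall z r :=
  Metric.mem_closedBall_comm.1 (mem_of_indicator_ne_zero h)

variable [OpensMeasurableSpace X]

lemma measurable_ballDensity [SecondCountableTopology X] [SFinite ρ] (r : ℝ) :
    Measurable fun p : X × X => ballDensity ρ r p.1 p.2 :=
  (((measurable_measure_closedBall ρ r).comp measurable_snd).inv).indicator
    (s := {p : X × X | dist p.1 p.2 ≤ r}) (measurableSet_le (by fun_prop) measurable_const)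

lemma measurable_ballDensity_left (r : ℝ) (x : X) : Measurable fun z => ballDensity ρ r z x :=
  measurable_const.indicator Metric.isClosed_closedBall.measurableSet

lemma lintegral_ballDensity [IsFiniteMeasure ρ]
    (hx : ρ (Metric.closedBall x r) ≠ 0) : ∫⁻ z, ballDensity ρ r z x ∂ρ = 1 := by
  unfold ballDensity
  rw [lintegral_indicator_const Metric.isClosed_closedBall.measurableSet,
    ENNReal.inv_mul_cancel hx (measure_ne_top _ _)]

lemma lintegral_ballDensity_mul_ballDensity_le [IsFiniteMeasure ρ]
    (hδ : δ ≠ 0) (hx : δ ≤ ρ (Metric.closedBall x r)) (hy : δ ≤ ρ (Metric.closedBall y r)) :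
    ∫⁻ z, ballDensity ρ r z x * ballDensity ρ r z y ∂ρ ≤
      {p : X × X | dist p.1 p.2 ≤ 2 * r}.indicator (fun _ => δ⁻¹) (x, y) := by
  have hle (z : X) : ballDensity ρ r z x * ballDensity ρ r z y ≤
      {p : X × X | dist p.1 p.2 ≤ 2 * r}.indicator (fun _ => δ⁻¹) (x, y) *
        ballDensity ρ r z y := by
    by_cases hz : z ∈ Metric.closedBall x r ∧ z ∈ Metric.closedBall y r
    · have hxy : dist x y ≤ 2 * r := by
        linarith [dist_triangle_left x y z, Metric.mem_closedBall.1 hz.1,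
          Metric.mem_closedBall.1 hz.2]
      gcongr
      rw [indicator_of_mem (by exact hxy), ballDensity, indicator_of_mem hz.1]
      exact ENNReal.inv_le_inv.2 hx
    · rcases not_and_or.1 hz with hz | hz <;> simp [ballDensity, indicator_of_notMem hz]
  calc ∫⁻ z, ballDensity ρ r z x * ballDensity ρ r z y ∂ρ
      ≤ ∫⁻ z, {p : X × X | dist p.1 p.2 ≤ 2 * r}.indicator (fun _ => δ⁻¹) (x, y) *
          ballDensity ρ r z y ∂ρ := lintegral_mono hle
    _ = {p : X × X | dist p.1 p.2 ≤ 2 * r}.indicator (fun _ => δ⁻¹) (x, y) := by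
      rw [lintegral_const_mul _ (measurable_ballDensity_left r y),
        lintegral_ballDensity ((pos_iff_ne_zero.2 hδ).trans_le hy).ne', mul_one]

end RandomBalls

lemma mul_measure_not_exists_energy_le_limsup_closedBall {X : Type*} [MetricSpace X]
    [SecondCountableTopology X] [MeasurableSpace X] [BorelSpace X] {ρ : Measure X}
    [IsFiniteMeasure ρ] {Ω : Type*} {mΩ : MeasurableSpace Ω} {P : Measure Ω} {κ : X × X → ℝ≥0∞}
    (hκ : Continuous κ) {J : Set X} (hV : minEnergy κ J ≠ ⊤) {ν : Measure X}
    (hν : ν ∈ compactProbMeasures J) {ε η : ℝ≥0∞} (hνV : energy κ ν ≤ minEnergy κ J + ε)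
    (hε : ε ≠ 0) (hη : η ≤ 1 / 4) {c : ℕ → Ω → X} (hc : iIndepFun c P) (hc' : ∀ k, Measurable (c k))
    (hcρ : ∀ k, P.map (c k) = ρ) {r : ℕ → ℝ} {δ : ℕ → ℝ≥0∞} (hδ : ∀ k, δ k ≠ 0) {m : ℕ}
    (hνδ : ∀ᵐ x ∂ν, ∀ k ≥ m, δ k ≤ ρ (Metric.closedBall x (r k))) {L : ℕ → ℝ≥0∞}
    (hL : ∀ k, L k ≠ 0) (hsum : ∑' k, (L k)⁻¹ = ⊤)
    (hνL : ∀ k ≥ m, (δ k)⁻¹ * (ν.prod ν) {p | dist p.1 p.2 ≤ 2 * r k} ≤ L k)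
    (hκL : ∀ k ≥ m, (δ k)⁻¹ * ∫⁻ p in {p | dist p.1 p.2 ≤ 2 * r k}, κ p ∂(ν.prod ν) ≤ L k) :
    η * P {ω | ¬∃ μ ∈ compactProbMeasures
        (limsup (fun k => Metric.closedBall (c k ω) (r k)) atTop ∩ J),
      energy κ μ ≤ minEnergy κ J + 4 * η} ≤ 3 * ε := by
  have := hν.1
  let S (k : ℕ) : Set (X × X) := {p | dist p.1 p.2 ≤ 2 * r k}
  have hS (k : ℕ) : MeasurableSet (S k) := measurableSet_le (by fun_prop) measurable_const
  have hdens (k : ℕ) (x : X) := measurable_ballDensity_left (ρ := ρ) (r k) x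
  have hmap (k : ℕ) {g : X → ℝ≥0∞} (hg : Measurable g) : ∫⁻ ω, g (c k ω) ∂P = ∫⁻ z, g z ∂ρ := by
    rw [← hcρ k, lintegral_map hg (hc' k)]
  have hmean : ∀ᵐ x ∂ν, ∀ k ≥ m, ∫⁻ ω, ballDensity ρ (r k) (c k ω) x ∂P = 1 := by
    filter_upwards [hνδ] with x hx k hk
    rw [hmap k (hdens k x)]
    exact lintegral_ballDensity ((pos_iff_ne_zero.2 (hδ k)).trans_le (hx k hk)).ne'
  have hcorr : ∀ᵐ p ∂(ν.prod ν), ∀ k ≥ m,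
      ∫⁻ ω, ballDensity ρ (r k) (c k ω) p.1 * ballDensity ρ (r k) (c k ω) p.2 ∂P ≤
        (S k).indicator (fun _ => (δ k)⁻¹) p := by
    filter_upwards [Measure.quasiMeasurePreserving_fst.ae hνδ,
      Measure.quasiMeasurePreserving_snd.ae hνδ] with p hx hy k hk
    exact (hmap k ((hdens k p.1).mul (hdens k p.2))).trans_le
      (lintegral_ballDensity_mul_ballDensity_le (hδ k) (hx k hk) (hy k hk))
  refine mul_measure_not_exists_energy_le hκ hV hν hνV hε hη
    (u := fun k ω => ballDensity ρ (r k) (c k ω))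
    (hc.comp _ fun k => measurable_pi_iff.2 (hdens k))
    (fun k => (measurable_ballDensity (ρ := ρ) (r k)).comp
      (by fun_prop : Measurable fun p : Ω × X => (c k p.1, p.2)))
    hmean hcorr (fun _ _ => Metric.isClosed_closedBall)
    (fun _ _ _ => mem_closedBall_of_ballDensity_ne_zero)
    (fun k => measurable_const.indicator (hS k)) (fun k => ENNReal.inv_ne_top.2 (hδ k))
    (fun k p => indicator_le_self _ _ p) hL hsum
    (fun k hk => (lintegral_indicator_const (hS k) _).trans_le (hνL k hk)) fun k hk => ?_
  calc ∫⁻ p, κ p * (S k).indicator (fun _ => (δ k)⁻¹) p ∂(ν.prod ν)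
      = ∫⁻ p in S k, κ p * (δ k)⁻¹ ∂(ν.prod ν) := by
        rw [← lintegral_indicator (hS k)]
        simp only [indicator_apply, mul_ite, mul_zero]
    _ = (δ k)⁻¹ * ∫⁻ p in S k, κ p ∂(ν.prod ν) := by
        rw [lintegral_mul_const _ hκ.measurable, mul_comm]
    _ ≤ L k := hκL k hk

lemma exists_le_smul_volume_ae_mem_lowerDensitySet {ρ : Measure ℝ} [IsFiniteMeasure ρ]
    {J : Set ℝ} (hJ : J.OrdConnected) (hJ' : J.Nontrivial) (hρ : ρ ≪ volume)
    (hρJ : volume.restrict J ≪ ρ) {r : ℕ → ℝ} (hr : ∀ k, 0 < r k) (hr' : Tendsto r atTop (𝓝 0))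
    {R c : ℝ≥0∞} (hR : R ≠ 0) (hR' : R ≠ ⊤) (hc : minEnergy (posLogKernel R) J < c) :
    ∃ m, ∃ ν ∈ compactProbMeasures J, ∃ D : ℝ≥0∞, D ≠ ⊤ ∧ ν ≤ D • volume ∧
      (∀ᵐ x ∂ν, x ∈ lowerDensitySet ρ r m) ∧ energy (posLogKernel R) ν < c := by
  obtain ⟨ν₀, hν₀, hc₀⟩ := (by simpa only [minEnergy, iInf_lt_iff, exists_prop] using hc :
    ∃ ν₀ ∈ compactProbMeasures J, energy (posLogKernel R) ν₀ < c)
  obtain ⟨ν₁, hν₁, D₁, hD₁, hνD₁, hc₁⟩ := exists_le_smul_volume_energy_lt hJ hJ' hR hR' hν₀ hc₀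
  have hν₁ρ : ν₁ ≪ ρ := by
    have hνJ : ν₁.restrict J = ν₁ :=
      Measure.restrict_eq_self_of_ae_mem (mem_of_superset Measure.support_mem_ae hν₁.2.2)
    exact hνJ ▸ ((Measure.absolutelyContinuous_of_le hνD₁).trans
      Measure.smul_absolutelyContinuous).restrict J |>.trans hρJ
  have hr₀ (k : ℕ) : 0 ≤ r k := (hr k).le
  obtain ⟨m, ν, hν, D, hD, hνD, hνm, hcν⟩ := exists_energy_lt_ae_mem hν₁
    measurableSet_lowerDensitySet (monotone_lowerDensitySet (ρ := ρ) hr₀)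
    (hν₁ρ.ae_le (ae_exists_mem_lowerDensitySet hρ
      (tendsto_nhdsWithin_iff.2 ⟨hr', Eventually.of_forall hr⟩) hr₀)) hc₁
  refine ⟨m, ν, hν, D * D₁, ENNReal.mul_ne_top hD hD₁, ?_, hνm, hcν⟩
  calc ν ≤ D • ν₁ := hνD
    _ ≤ D • D₁ • volume := by gcongr
    _ = (D * D₁) • volume := smul_smul ..

lemma inv_ofReal_div_mul_eq {t a : ℝ} (ht : 0 < t) (ha : 0 < a) (D : ℝ≥0∞) :
    (ENNReal.ofReal (t / a))⁻¹ * (D * ENNReal.ofReal (2 * (2 * t))) =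
      4 * ENNReal.ofReal a * D := by
  have h : (t / a)⁻¹ * (2 * (2 * t)) = 4 * a := by field_simp; ring
  rw [← ENNReal.ofReal_inv_of_pos (by positivity), mul_left_comm,
    ← ENNReal.ofReal_mul (by positivity), h, ENNReal.ofReal_mul (by norm_num), mul_comm]
  simp

lemma tsum_mul_inv_eq_top {l : ℕ → ℝ≥0∞} {A : ℝ≥0∞} (hA : A ≠ 0) (hA' : A ≠ ⊤)
    (h : ∑' k, (l k)⁻¹ = ⊤) : ∑' k, (A * l k)⁻¹ = ⊤ := by
  simp only [ENNReal.mul_inv (.inl hA) (.inl hA'), ENNReal.tsum_mul_left, h]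
  exact ENNReal.mul_top (ENNReal.inv_ne_zero.2 hA')

section RandomIntervals

variable {Ω : Type*} {mΩ : MeasurableSpace Ω} {P : Measure Ω} {ρ : Measure ℝ} [IsFiniteMeasure ρ]
  {c : ℕ → Ω → ℝ} {J : Set ℝ} {r : ℕ → ℝ} {R : ℝ} {ε η : ℝ≥0∞}

lemma mul_measure_not_exists_energy_posLogKernel_le (hc : iIndepFun c P)
    (hc' : ∀ k, Measurable (c k)) (hcρ : ∀ k, P.map (c k) = ρ) (hJ : J.OrdConnected)
    (hJ' : J.Nontrivial) (hρ : ρ ≪ volume) (hρJ : volume.restrict J ≪ ρ)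
    (hr : ∀ k, 0 < r k) (hr' : Tendsto r atTop (𝓝 0)) (hR : 0 < R)
    (hsum : ∑' k, (eposLog (ENNReal.ofReal R / ENNReal.ofReal (2 * r k)) + 1)⁻¹ = ⊤)
    (hε : ε ≠ 0) (hη : η ≤ 1 / 4) :
    η * P {ω | ¬∃ μ ∈ compactProbMeasures
        (limsup (fun k => Metric.closedBall (c k ω) (r k)) atTop ∩ J),
      energy (posLogKernel (ENNReal.ofReal R)) μ ≤
        minEnergy (posLogKernel (ENNReal.ofReal R)) J + 4 * η} ≤ 3 * ε := by
  have hV := minEnergy_posLogKernel_ne_top hJ hJ' hR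
  obtain ⟨m, ν, hν, D, hD, hνD, hνm, hνV⟩ := exists_le_smul_volume_ae_mem_lowerDensitySet hJ hJ' hρ
    hρJ hr hr' (by simpa using hR) ENNReal.ofReal_ne_top (ENNReal.lt_add_right hV hε)
  have := hν.1
  have hD₀ : D ≠ 0 := by
    rintro rfl
    simpa using hνD univ
  have hm : (0 : ℝ) < m + 1 := by positivity
  set A : ℝ≥0∞ := 4 * ENNReal.ofReal (m + 1) * D with hA
  have hA₀ : A ≠ 0 := by simp [hA, hD₀, hm]
  have hA' : A ≠ ⊤ := by finiteness
  have hδ (k : ℕ) : ENNReal.ofReal (r k / (m + 1)) ≠ 0 := by simpa using div_pos (hr k) hm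
  refine mul_measure_not_exists_energy_le_limsup_closedBall (X := ℝ)
    (continuous_posLogKernel ENNReal.ofReal_ne_top) hV hν hνV.le hε hη hc hc' hcρ hδ hνm
    (fun k => mul_ne_zero hA₀ (by simp)) (tsum_mul_inv_eq_top hA₀ hA' hsum)
    (fun k _ => ?_) fun k _ => ?_
  · calc _ ≤ (ENNReal.ofReal (r k / (m + 1)))⁻¹ * (D * ENNReal.ofReal (2 * (2 * r k))) := by
          gcongr
          exact measure_prod_dist_le hνD
      _ = A := inv_ofReal_div_mul_eq (hr k) hm D
      _ ≤ A * _ := le_mul_of_one_le_right' le_add_self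
  · calc _ ≤ (ENNReal.ofReal (r k / (m + 1)))⁻¹ * (D * ENNReal.ofReal (2 * (2 * r k)) *
          (eposLog (ENNReal.ofReal R / ENNReal.ofReal (2 * r k)) + 1)) := by
          gcongr
          exact setLIntegral_posLogKernel_le (mul_pos two_pos (hr k)) hνD _
      _ = A * _ := by rw [← mul_assoc, inv_ofReal_div_mul_eq (hr k) hm D]

lemma ae_minEnergy_limsup_closedBall_le (hc : iIndepFun c P)
    (hc' : ∀ k, Measurable (c k)) (hcρ : ∀ k, P.map (c k) = ρ) (hJ : J.OrdConnected)
    (hJ' : J.Nontrivial) (hρ : ρ ≪ volume) (hρJ : volume.restrict J ≪ ρ)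
    (hr : ∀ k, 0 < r k) (hr' : Tendsto r atTop (𝓝 0)) (hR : 0 < R)
    (hsum : ∑' k, (eposLog (ENNReal.ofReal R / ENNReal.ofReal (2 * r k)) + 1)⁻¹ = ⊤) :
    ∀ᵐ ω ∂P, minEnergy (posLogKernel (ENNReal.ofReal R))
        (limsup (fun k => Metric.closedBall (c k ω) (r k)) atTop ∩ J) ≤
      minEnergy (posLogKernel (ENNReal.ofReal R)) J := by
  have hae (n : ℕ) : ∀ᵐ ω ∂P, ∃ μ ∈ compactProbMeasures
      (limsup (fun k => Metric.closedBall (c k ω) (r k)) atTop ∩ J),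
        energy (posLogKernel (ENNReal.ofReal R)) μ ≤
          minEnergy (posLogKernel (ENNReal.ofReal R)) J + 4 * ((n + 4 : ℕ) : ℝ≥0∞)⁻¹ := by
    have hη : ((n + 4 : ℕ) : ℝ≥0∞)⁻¹ ≤ 1 / 4 := by
      rw [one_div]
      gcongr
      exact_mod_cast Nat.le_add_left 4 n
    refine (mul_eq_zero.1 (le_zero_iff.1 ?_)).resolve_left
      (ENNReal.inv_ne_zero.2 (ENNReal.natCast_ne_top (n + 4)))
    have hlim : Tendsto (fun ε : ℝ≥0∞ => 3 * ε) (𝓝[>] 0) (𝓝 0) := by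
      simpa using (ENNReal.Tendsto.const_mul (a := 3) tendsto_id (.inr (by simp))).mono_left
        (nhdsWithin_le_nhds (a := (0 : ℝ≥0∞)) (s := Ioi 0))
    refine ge_of_tendsto hlim ?_
    filter_upwards [self_mem_nhdsWithin] with ε hε
    exact mul_measure_not_exists_energy_posLogKernel_le hc hc' hcρ hJ hJ' hρ hρJ hr hr' hR hsum
      hε.ne' hη
  filter_upwards [ae_all_iff.2 hae] with ω hω
  have hlim : Tendsto (fun n : ℕ => minEnergy (posLogKernel (ENNReal.ofReal R)) J +
      4 * ((n + 4 : ℕ) : ℝ≥0∞)⁻¹) atTop (𝓝 (minEnergy (posLogKernel (ENNReal.ofReal R)) J)) := by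
    simpa using tendsto_const_nhds.add ((ENNReal.Tendsto.const_mul (a := 4)
      ENNReal.tendsto_inv_nat_nhds_zero (.inr (by simp))).comp (tendsto_add_atTop_nat 4))
  refine ge_of_tendsto' hlim fun n => ?_
  obtain ⟨μ, hμ, hle⟩ := hω n
  exact (minEnergy_le hμ).trans hle

end RandomIntervals

lemma tsum_inv_eposLog_add_one_eq_top {l : ℕ → ℝ} (hl : ∀ k, 0 < l k)
    (hl' : Tendsto l atTop (𝓝 0)) (h : ¬Summable fun k => (Real.log (l k))⁻¹) {R : ℝ}
    (hR : 0 < R) : ∑' k, (eposLog (ENNReal.ofReal R / ENNReal.ofReal (l k)) + 1)⁻¹ = ⊤ := by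
  contrapose! h
  have hlog : ∀ᶠ k in atTop, Real.log (l k) < -(|Real.log R| + 1) :=
    (Real.tendsto_log_nhdsGT_zero.comp
      (tendsto_nhdsWithin_iff.2 ⟨hl', .of_forall hl⟩)).eventually_lt_atBot _
  refine ((ENNReal.summable_toReal h).mul_left 2).of_norm_bounded_eventually_nat ?_
  filter_upwards [hlog] with k hk
  have hlogR := le_abs_self (Real.log R)
  have hlogR' := abs_nonneg (Real.log R)
  have hle : eposLog (ENNReal.ofReal R / ENNReal.ofReal (l k)) + 1 ≤
      ENNReal.ofReal (2 * -Real.log (l k)) := by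
    rw [← ENNReal.ofReal_div_of_pos (hl k), eposLog_ofReal (div_pos hR (hl k)),
      Real.log_div hR.ne' (hl k).ne', ← ENNReal.ofReal_one,
      ← ENNReal.ofReal_add (by linarith [neg_abs_le (Real.log R)]) zero_le_one]
    exact ENNReal.ofReal_le_ofReal (by linarith)
  have hinv : (2 * -Real.log (l k))⁻¹ ≤
      (eposLog (ENNReal.ofReal R / ENNReal.ofReal (l k)) + 1)⁻¹.toReal := by
    rw [← ENNReal.ofReal_le_iff_le_toReal (by simp), ENNReal.ofReal_inv_of_pos (by linarith)]
    gcongr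
  rw [Real.norm_eq_abs, abs_inv, abs_of_neg (by linarith)]
  rw [mul_inv] at hinv
  linarith

section LimsupIntervals

variable {J : Set ℝ}

lemma limsupIntervals_eq_limsup_ball (c l : ℕ → ℝ) :
    limsupIntervals c l = limsup (fun k => Metric.ball (c k) (l k / 2)) atTop := by
  simp only [limsupIntervals, limsup_eq_iInf_iSup_of_nat, Real.ball_eq_Ioo]
  rfl

lemma limsup_closedBall_subset_limsupIntervals {c l : ℕ → ℝ} (hl : ∀ k, 0 < l k) :
    limsup (fun k => Metric.closedBall (c k) (l k / 4)) atTop ⊆ limsupIntervals c l := by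
  rw [limsupIntervals_eq_limsup_ball]
  refine limsup_le_limsup (.of_forall fun k => Metric.closedBall_subset_ball ?_)
  linarith [hl k]

lemma limsupIntervals_subset_of_mem (hJ : J.OrdConnected) (hJb : Bornology.IsBounded J)
    {c l : ℕ → ℝ} (hl : Tendsto l atTop (𝓝 0)) (hc : ∀ k, c k ∈ J)
    (hinf : sInf J ∉ limsupIntervals c l) (hsup : sSup J ∉ limsupIntervals c l) :
    limsupIntervals c l ⊆ J := by
  intro x hx
  have hxJ : x ∈ closure J := by
    refine Metric.mem_closure_iff.2 fun ε hε => ?_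
    rw [limsupIntervals_eq_limsup_ball, mem_limsup_iff_frequently_mem] at hx
    obtain ⟨k, hxk, hk⟩ := (hx.and_eventually (hl.eventually_lt_const (mul_pos two_pos hε))).exists
    exact ⟨c k, hc k, (Metric.mem_ball.1 hxk).trans (by linarith)⟩
  have hxIcc : x ∈ Icc (sInf J) (sSup J) :=
    closure_minimal hJb.subset_Icc_sInf_sSup isClosed_Icc hxJ
  have hJconn : IsConnected J := ⟨⟨c 0, hc 0⟩, hJ.isPreconnected⟩
  exact hJconn.Ioo_csInf_csSup_subset hJb.bddBelow hJb.bddAbove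
    ⟨hxIcc.1.lt_of_ne (by rintro rfl; exact hinf hx),
      hxIcc.2.lt_of_ne (by rintro rfl; exact hsup hx)⟩

lemma minEnergy_posLogKernel_image_ofReal (R : ℝ≥0∞) (E : Set ℝ) :
    minEnergy (posLogKernel R) (Complex.ofReal '' E) = minEnergy (posLogKernel R) E :=
  minEnergy_posLogKernel_image R Complex.isometry_ofReal Complex.isometry_ofReal.isClosedEmbedding E

lemma edist_le_ofReal_max_diam (hJ : Bornology.IsBounded J) :
    ∀ z ∈ Complex.ofReal '' J, ∀ w ∈ Complex.ofReal '' J,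
      edist z w ≤ ENNReal.ofReal (max 1 (Metric.diam J)) := by
  rintro _ ⟨x, hx, rfl⟩ _ ⟨y, hy, rfl⟩
  rw [Complex.isometry_ofReal.edist_eq, edist_dist]
  exact ENNReal.ofReal_le_ofReal ((Metric.dist_le_diam_of_mem hJ hx hy).trans (le_max_right _ _))

lemma logCapacity_image_ofReal_pos (hJ : J.OrdConnected) (hJb : Bornology.IsBounded J)
    (hJ' : J.Nontrivial) : 0 < logCapacity (Complex.ofReal '' J) := by
  refine logCapacity_pos (by simp) ENNReal.ofReal_ne_top (edist_le_ofReal_max_diam hJb) ?_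
  rw [minEnergy_posLogKernel_image_ofReal]
  exact minEnergy_posLogKernel_ne_top hJ hJ' (by positivity)

variable {Ω : Type*} {mΩ : MeasurableSpace Ω} {P : Measure Ω} {ρ : Measure ℝ} {c : ℕ → Ω → ℝ}
  {l : ℕ → ℝ} {D : ℝ≥0∞}

lemma ae_notMem_limsupIntervals (hc : ∀ k, Measurable (c k)) (hcρ : ∀ k, P.map (c k) = ρ)
    (hD : D ≠ ⊤) (hρ : ρ ≤ D • volume) (hl : Summable l) (p : ℝ) :
    ∀ᵐ ω ∂P, p ∉ limsupIntervals (fun k => c k ω) l := by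
  have hle (k : ℕ) : P {ω | p ∈ Metric.ball (c k ω) (l k / 2)} ≤ D * ENNReal.ofReal (l k) := by
    calc P {ω | p ∈ Metric.ball (c k ω) (l k / 2)} = ρ (Metric.ball p (l k / 2)) := by
          simp only [Metric.mem_ball_comm, ← hcρ k]
          exact (Measure.map_apply (hc k) measurableSet_ball).symm
      _ ≤ D * volume (Metric.ball p (l k / 2)) := hρ _
      _ = D * ENNReal.ofReal (l k) := by rw [Real.volume_ball, mul_div_cancel₀ _ two_ne_zero]
  have hsum : ∑' k, P {ω | p ∈ Metric.ball (c k ω) (l k / 2)} ≠ ⊤ :=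
    ne_top_of_le_ne_top (ENNReal.tsum_mul_left ▸ ENNReal.mul_ne_top hD hl.tsum_ofReal_ne_top)
      (ENNReal.tsum_le_tsum hle)
  filter_upwards [ae_eventually_notMem hsum] with ω hω
  rwa [limsupIntervals_eq_limsup_ball, mem_limsup_iff_frequently_mem, not_frequently]

lemma ae_hasFullCapacity_limsupIntervals (hc : iIndepFun c P) (hc' : ∀ k, Measurable (c k))
    (hcρ : ∀ k, P.map (c k) = ρ) (hJ : J.OrdConnected) (hJb : Bornology.IsBounded J)
    (hJ' : J.Nontrivial) (hD : D ≠ ⊤) (hρ : ρ ≤ D • volume) (hρJ : volume.restrict J ≪ ρ)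
    (hJρ : ∀ᵐ x ∂ρ, x ∈ J) (hl : ∀ k, 0 < l k) (hl' : Summable l)
    (hlog : ¬Summable fun k => (Real.log (l k))⁻¹) :
    ∀ᵐ ω ∂P, HasFullCapacity (Complex.ofReal '' limsupIntervals (fun k => c k ω) l)
      (Complex.ofReal '' J) := by
  have := hc.isProbabilityMeasure
  have : IsProbabilityMeasure ρ := hcρ 0 ▸ Measure.isProbabilityMeasure_map (hc' 0).aemeasurable
  have hR : 0 < max 1 (Metric.diam J) := by positivity
  have hl₀ := hl'.tendsto_atTop_zero
  have hsum : ∑' k, (eposLog (ENNReal.ofReal (max 1 (Metric.diam J)) /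
      ENNReal.ofReal (2 * (l k / 4))) + 1)⁻¹ = ⊤ := by
    convert tsum_inv_eposLog_add_one_eq_top hl hl₀ hlog (mul_pos two_pos hR) using 6 with k
    rw [← ENNReal.ofReal_div_of_pos (hl k), ← ENNReal.ofReal_div_of_pos (by linarith [hl k])]
    congr 1
    field_simp
    norm_num
  have hmem : ∀ᵐ ω ∂P, ∀ k, c k ω ∈ J :=
    ae_all_iff.2 fun k => ae_of_ae_map (hc' k).aemeasurable (hcρ k ▸ hJρ)
  filter_upwards [hmem, ae_notMem_limsupIntervals hc' hcρ hD hρ hl' (sInf J),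
    ae_notMem_limsupIntervals hc' hcρ hD hρ hl' (sSup J),
    ae_minEnergy_limsup_closedBall_le hc hc' hcρ hJ hJ'
      (Measure.absolutelyContinuous_of_le_smul hρ) hρJ (fun k => div_pos (hl k) four_pos)
      (by simpa using hl₀.div_const 4) hR hsum] with ω hω hinf hsup hle
  refine hasFullCapacity_of_minEnergy_le (by simp) ENNReal.ofReal_ne_top
    (edist_le_ofReal_max_diam hJb)
    (image_mono (limsupIntervals_subset_of_mem hJ hJb hl₀ hω hinf hsup)) ?_
  simp only [minEnergy_posLogKernel_image_ofReal]
  exact (minEnergy_anti (inter_subset_left.trans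
    (limsup_closedBall_subset_limsupIntervals hl))).trans hle

end LimsupIntervals

lemma summable_exp_neg_mul_natCast {a : ℝ} (ha : 0 < a) :
    Summable fun k : ℕ => Real.exp (-a * k) := by
  simpa only [mul_comm] using Real.summable_exp_nat_mul_iff.2 (neg_lt_zero.2 ha)

lemma not_summable_inv_log_exp_mul_natCast {a : ℝ} (ha : a ≠ 0) :
    ¬Summable fun k : ℕ => (Real.log (Real.exp (a * k)))⁻¹ := by
  simpa only [Real.log_exp, mul_inv, summable_mul_left_iff (inv_ne_zero ha)] using
    Real.not_summable_natCast_inv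

theorem mainTheorem3_general {Ω : Type*} [MeasurableSpace Ω] (P : Measure Ω) (J : Set ℝ)
    (hJ_interval : J.OrdConnected) (hJ_bounded : Bornology.IsBounded J)
    (hJ_nontrivial : J.Nontrivial) (f : ℝ → ℝ) (M : ℝ)
    (hf_meas : AEMeasurable f (volume.restrict J))
    (hf_pos : ∀ᵐ x ∂(volume.restrict J), 0 < f x)
    (hf_le : ∀ᵐ x ∂(volume.restrict J), f x ≤ M)
    (c : ℕ → Ω → ℝ) (hc_meas : ∀ k, AEMeasurable (c k) P) (hc_indep : iIndepFun c P)
    (hc_law : ∀ k, P.map (c k) =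
      (volume.restrict J).withDensity (fun x => ENNReal.ofReal (f x)))
    (l : ℕ → ℝ) (hl_pos : ∀ k, 0 < l k) (hl_sum : Summable l)
    (hl_log : ¬Summable fun k => (Real.log (l k))⁻¹) :
    ∀ᵐ ω ∂P,
      HasFullCapacity (Complex.ofReal '' limsupIntervals (fun k => c k ω) l)
        (Complex.ofReal '' J) ∧
      0 < logCapacity (Complex.ofReal '' J) := by
  have hρ : (volume.restrict J).withDensity (fun x => ENNReal.ofReal (f x)) ≤
      ENNReal.ofReal M • volume := by
    calc _ ≤ (volume.restrict J).withDensity (fun _ => ENNReal.ofReal M) :=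
          withDensity_mono (hf_le.mono fun x hx => ENNReal.ofReal_le_ofReal hx)
      _ = ENNReal.ofReal M • volume.restrict J := withDensity_const _
      _ ≤ ENNReal.ofReal M • volume := smul_le_smul_left _ Measure.restrict_le_self
  have hρJ : volume.restrict J ≪
      (volume.restrict J).withDensity (fun x => ENNReal.ofReal (f x)) :=
    withDensity_absolutelyContinuous' hf_meas.ennreal_ofReal
      (hf_pos.mono fun x hx => (ENNReal.ofReal_pos.2 hx).ne')
  have hJρ : ∀ᵐ x ∂(volume.restrict J).withDensity (fun x => ENNReal.ofReal (f x)), x ∈ J :=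
    (withDensity_absolutelyContinuous _ _).ae_le (ae_restrict_mem hJ_interval.measurableSet)
  have hmk (k : ℕ) : c k =ᵐ[P] (hc_meas k).mk (c k) := (hc_meas k).ae_eq_mk
  filter_upwards [ae_all_iff.2 hmk, ae_hasFullCapacity_limsupIntervals (hc_indep.congr hmk)
    (fun k => (hc_meas k).measurable_mk) (fun k => Measure.map_congr (hmk k) ▸ hc_law k)
    hJ_interval hJ_bounded hJ_nontrivial ENNReal.ofReal_ne_top hρ hρJ hJρ hl_pos hl_sum hl_log]
    with ω hω hfull
  simp only [hω]
  exact ⟨hfull, logCapacity_image_ofReal_pos hJ_interval hJ_bounded hJ_nontrivial⟩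

theorem mainTheorem3 {Ω : Type*} [MeasurableSpace Ω] (P : Measure Ω) [IsProbabilityMeasure P]
    (J : Set ℝ) (hJ_interval : J.OrdConnected) (hJ_bounded : Bornology.IsBounded J)
    (hJ_nontrivial : J.Nontrivial)
    (f : ℝ → ℝ) (M : ℝ)
    (hf_meas : AEMeasurable f (volume.restrict J))
    (hf_pos : ∀ᵐ x ∂(volume.restrict J), 0 < f x)
    (hf_le : ∀ᵐ x ∂(volume.restrict J), f x ≤ M)
    (c : ℕ → Ω → ℝ)
    (hc_meas : ∀ k, AEMeasurable (c k) P)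
    (hc_indep : iIndepFun c P)
    (hc_law : ∀ k, P.map (c k) =
      (volume.restrict J).withDensity (fun x => ENNReal.ofReal (f x)))
    (lam : ℝ) (hlam : 0 < lam) :
    ∀ᵐ ω ∂P,
      HasFullCapacity
        (Complex.ofReal '' limsupIntervals (fun k => c k ω) (fun k => Real.exp (-lam * k)))
        (Complex.ofReal '' J) ∧
      0 < logCapacity (Complex.ofReal '' J) :=
  mainTheorem3_general P J hJ_interval hJ_bounded hJ_nontrivial f M hf_meas hf_pos hf_le c hc_meas
    hc_indep hc_law _ (fun _ => Real.exp_pos _) (summable_exp_neg_mul_natCast hlam)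
    (not_summable_inv_log_exp_mul_natCast (neg_ne_zero.2 hlam.ne'))
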